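/- **Proposition.** Let $(Q,\mathcal U)$ be a reduced (smooth) orbifold and let $\varepsilon$ be a lift of the identity $\mathrm{id}_{(Q,\mathcal U)}$. Then the equivalence class $[\varepsilon]$ of $\varepsilon$ in the class of charted orbifold maps consists precisely of all lifts of $\mathrm{id}_{(Q,\mathcal U)}$. Here the notions are as follows. An *orbifold chart* of dimension $n$ on $Q$ is a triple $(V,G,\pi)$ with $V$ a connected smooth $n$-manifold, $G$ a finite group of diffeomorphisms of $V$, and $\pi\colon V\to Q$ a map with open image inducing a homeomorphism $G\backslash V\to\pi(V)$. Two charts are *compatible* if any points $x\in V$, $y\in W$ over the same point of $Q$ are related by a diffeomorphism between open neighbourhoods that commutes with the projections. An *orbifold atlas* is a set of pairwise compatible charts (of dimension $n$) covering $Q$; an *orbifold structure* $\mathcal U$ is a maximal atlas; an atlas contained in $\mathcal U$ is a *representative* of $\mathcal U$. A *reduced orbifold* $(Q,\mathcal U)$ is a second countable Hausdorff space $Q$ with an orbifold structure $\mathcal U$. For an atlas $\mathcal V=\{(V_i,G_i,\pi_i)\}_{i\in I}$, $\Psi(\mathcal V)$ is the set of diffeomorphisms between open subsets of $\coprod_i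 V_i$ commuting with the projection to $Q$; a *change of charts* is an element of $\Psi(\mathcal V)$ with domain in one $V_i$ and image in one $V_j$. A *representative of an orbifold map* from $\mathcal V$ (an atlas on $Q$) to $\mathcal V'$ (an atlas on $Q'$) is a tuple $(f,\{\tilde f_i\}_{i\in I},P,\nu)$ where $f\colon Q\to Q'$ is continuous; each $\tilde f_i\colon V_i\to V'_{\alpha(i)}$ is a smooth map with $\pi'_{\alpha(i)}\circ\tilde f_i=f\circ\pi_i$; $P$ is a quasi-pseudogroup (inverses and compositions exist locally in $P$) of changes of charts of $\mathcal V$ which generates $\Psi(\mathcal V)$ (each element of $\Psi(\mathcal V)$ agrees locally with elements of $P$); and, with $\psi=\coprod_i\tilde f_i$, $\nu$ assigns to each $\lambda\in P$ an element $\nu(\lambda)$ of $\Psi(\mathcal V')$ that is an open embedding of an orbifold chart, carried by an open subset of some $V'_j$, into some $V'_k$, such that $\psi(\operatorname{dom}\lambda)\subseteq\operatorname{dom}\nu(\lambda)$, $\psi\circ\lambda=\nu(\lambda)\circ\psi|_{\operatorname{dom}\lambda}$, and the assignment $\operatorname{germ}_x\lambda\mapsto\operatorname{germ}_{\psi(x)}\nu(\lambda)$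 is well defined, compatible with composition of germs and maps identity germs to identity germs. Two representatives are identified if they have the same $f$ and the same $\tilde f_i$, and $\operatorname{germ}_{\psi(x)}\nu_1(\lambda_1)=\operatorname{germ}_{\psi(x)}\nu_2(\lambda_2)$ whenever $\operatorname{germ}_x\lambda_1=\operatorname{germ}_x\lambda_2$. The classes $(f,\{\tilde f_i\},[P,\nu])$ are the *charted orbifold maps*, and form the set $\mathrm{Orbmap}(\mathcal V,\mathcal V')$; they are composed by composing the maps $f$, the local lifts and the assignments of germs. A *lift of* $\mathrm{id}_{(Q,\mathcal U)}$ is a charted orbifold map $(f,\{\tilde f_i\},[P,\nu])$ from an atlas $\mathcal V$ representing $\mathcal U$ to an atlas $\mathcal V'$ on $Q$ (of the same dimension) such that $f=\mathrm{id}_Q$ and every $\tilde f_i$ is a local diffeomorphism. Charted orbifold maps $\hat f_k\in\mathrm{Orbmap}(\mathcal V_k,\mathcal V'_k)$, $k=1,2$, where $\mathcal V_1,\mathcal V_2$ represent the same orbifold structure $\mathcal U$ on $Q$ and $\mathcal V'_1,\mathcal V'_2$ represent the same orbifold structure $\mathcal U'$ on $Q'$, are *equivalent* if there are representatives $\mathcal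 W$ of $\mathcal U$ and $\mathcal W'$ of $\mathcal U'$, lifts of the identity $\varepsilon_k\in\mathrm{Orbmap}(\mathcal W,\mathcal V_k)$ of $(Q,\mathcal U)$ and $\varepsilon'_k\in\mathrm{Orbmap}(\mathcal W',\mathcal V'_k)$ of $(Q',\mathcal U')$, and $\hat h\in\mathrm{Orbmap}(\mathcal W,\mathcal W')$ such that $\hat f_k\circ\varepsilon_k=\varepsilon'_k\circ\hat h$ for $k=1,2$. The class $[\varepsilon]$ is taken with respect to this relation. -/

import Mathlib

open Set Filter Topology
open scoped Manifold ContDiff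

universe u

namespace ReducedOrbifold

/-! ### Orbifold charts, atlases and structures -/

/-- A reduced orbifold chart `(V, G, π)` of dimension `n` on `Q`: a connected smooth `n`-manifold
`V` (Hausdorff, second countable, without boundary), a finite group `G` of diffeomorphisms of `V`
and a map `π : V → Q` with open image which induces a homeomorphism from `G \ V` onto `π(V)`.
As `G` is closed under inverses, it suffices to ask that the elements of `G` be smooth. -/
structure OrbifoldChart (n : ℕ) (Q : Type u) [TopologicalSpace Q] where
  carrier : Type u
  [top : TopologicalSpace carrier]
  [charted : ChartedSpace (EuclideanSpace ℝ (Fin n)) carrier]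
  [manifold : IsManifold (𝓡 n) ∞ carrier]
  [t2 : T2Space carrier]
  [secondCountable : SecondCountableTopology carrier]
  [connected : ConnectedSpace carrier]
  G : Subgroup (carrier ≃ₜ carrier)
  finite_G : Finite G
  smooth_G : ∀ g ∈ G, ContMDiff (𝓡 n) (𝓡 n) ∞ g
  proj : carrier → Q
  isOpen_range : IsOpen (range proj)
  /-- The map induced on `G \ V` is well defined and injective. -/
  proj_eq_iff : ∀ x y, proj x = proj y ↔ ∃ g ∈ G, g x = y
  /-- The image of `proj` carries the quotient topology. -/
  isQuotientMap : IsQuotientMap (rangeFactorization proj)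

attribute [instance] OrbifoldChart.top OrbifoldChart.charted OrbifoldChart.manifold
  OrbifoldChart.t2 OrbifoldChart.secondCountable OrbifoldChart.connected

/-- A transition: a diffeomorphism between open subsets (the source and the target). -/
def IsTransition {n : ℕ} {M N : Type u} [TopologicalSpace M] [TopologicalSpace N]
    [ChartedSpace (EuclideanSpace ℝ (Fin n)) M] [ChartedSpace (EuclideanSpace ℝ (Fin n)) N]
    (f : OpenPartialHomeomorph M N) : Prop :=
  ContMDiffOn (𝓡 n) (𝓡 n) ∞ f f.source ∧ ContMDiffOn (𝓡 n) (𝓡 n) ∞ f.symm f.target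

section Charts

variable {n : ℕ} {Q : Type u} [TopologicalSpace Q]

/-- Two charts are compatible if any two points over the same point of `Q` are related by a
diffeomorphism between open neighbourhoods which commutes with the projections. -/
def OrbifoldChart.Compatible (C D : OrbifoldChart n Q) : Prop :=
  ∀ (x : C.carrier) (y : D.carrier), C.proj x = D.proj y →
    ∃ h : OpenPartialHomeomorph C.carrier D.carrier, IsTransition (n := n) h ∧
      x ∈ h.source ∧ h x = y ∧ ∀ z ∈ h.source, D.proj (h z) = C.proj z

/-- An open embedding of orbifold charts: an open embedding of manifolds (a diffeomorphism onto an
open subset) which commutes with the projections. -/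
def OrbifoldChart.IsEmbedding (C D : OrbifoldChart n Q) (e : C.carrier → D.carrier) : Prop :=
  IsOpenEmbedding e ∧ IsLocalDiffeomorph (𝓡 n) (𝓡 n) ∞ e ∧ ∀ x, D.proj (e x) = C.proj x

/-- An orbifold atlas: a collection of pairwise compatible charts which cover `Q`. Being a set, an
atlas lists each of its charts once; it is used as its own index set. -/
structure OrbifoldAtlas (n : ℕ) (Q : Type u) [TopologicalSpace Q] where
  charts : Set (OrbifoldChart n Q)
  compatible : ∀ C ∈ charts, ∀ D ∈ charts, C.Compatible D
  covers : ∀ q : Q, ∃ C ∈ charts, q ∈ range C.proj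

/-- An orbifold structure: a maximal orbifold atlas. -/
structure OrbifoldStructure (n : ℕ) (Q : Type u) [TopologicalSpace Q]
    extends OrbifoldAtlas n Q where
  maximal : ∀ A : OrbifoldAtlas n Q, charts ⊆ A.charts → A.charts ⊆ charts

namespace OrbifoldAtlas

/-- The atlas `V` is a representative of the orbifold structure `U`. -/
def IsRepresentative (V : OrbifoldAtlas n Q) (U : OrbifoldStructure n Q) : Prop :=
  V.charts ⊆ U.charts

/-- The charts of the orbifold structure that is represented by `V`. -/
def structureCharts (V : OrbifoldAtlas n Q) : Set (OrbifoldChart n Q) :=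
  {C | ∀ D ∈ V.charts, C.Compatible D}

/-- The disjoint union of all charts of the atlas. -/
abbrev Total (V : OrbifoldAtlas n Q) : Type _ := Σ C : V.charts, C.1.carrier

/-- The manifold structure on the disjoint union: its charts are those of the summands. -/
noncomputable instance (V : OrbifoldAtlas n Q) :
    ChartedSpace (EuclideanSpace ℝ (Fin n)) V.Total where
  atlas := ⋃ C : V.charts,
    (fun e : OpenPartialHomeomorph C.1.carrier (EuclideanSpace ℝ (Fin n)) =>
      e.lift_openEmbedding (IsOpenEmbedding.sigmaMk (σ := fun C : V.charts => C.1.carrier) (i := C))) ''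
      atlas (EuclideanSpace ℝ (Fin n)) C.1.carrier
  chartAt p := (chartAt (EuclideanSpace ℝ (Fin n)) p.2).lift_openEmbedding
    (IsOpenEmbedding.sigmaMk (σ := fun C : V.charts => C.1.carrier) (i := p.1))
  mem_chart_source p := by
    rw [OpenPartialHomeomorph.lift_openEmbedding_source]
    exact ⟨p.2, mem_chart_source _ _, rfl⟩
  chart_mem_atlas p := mem_iUnion.2 ⟨p.1, _, chart_mem_atlas _ p.2, rfl⟩

/-- The projection of the disjoint union to `Q`. -/
def proj (V : OrbifoldAtlas n Q) (p : V.Total) : Q := p.1.1.proj p.2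

/-- The pseudogroup `Ψ(V)` of all transitions on the disjoint union which commute with the
projection. -/
def Psi (V : OrbifoldAtlas n Q) : Set (OpenPartialHomeomorph V.Total V.Total) :=
  {f | IsTransition (n := n) f ∧ ∀ p ∈ f.source, V.proj (f p) = V.proj p}

/-- The changes of charts of the atlas: those elements of `Ψ(V)` which lead from an open subset of
one chart to an open subset of one chart. -/
def IsChangeOfCharts (V : OrbifoldAtlas n Q) (f : OpenPartialHomeomorph V.Total V.Total) : Prop :=
  f ∈ V.Psi ∧ ∃ C D : V.charts, f.source ⊆ range (Sigma.mk C) ∧ f.target ⊆ range (Sigma.mk D)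

/-- The elements of `Ψ(V)` which are open embeddings between orbifold charts of the orbifold
structure: the domain is an open subset of a chart of `V` that is itself (the image under an open
embedding `e` of) a chart `E` of the structure, and the map is an open embedding of it into a
chart of `V`. -/
def IsChartEmbedding (V : OrbifoldAtlas n Q) (f : OpenPartialHomeomorph V.Total V.Total) : Prop :=
  f ∈ V.Psi ∧ ∃ E ∈ V.structureCharts, ∃ C D : V.charts,
    ∃ (e : E.carrier → C.1.carrier) (e' : E.carrier → D.1.carrier),
      E.IsEmbedding C.1 e ∧ E.IsEmbedding D.1 e' ∧
      f.source = range (fun x => (⟨C, e x⟩ : V.Total)) ∧ ∀ x, f ⟨C, e x⟩ = ⟨D, e' x⟩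

end OrbifoldAtlas

end Charts

/-! ### Quasi-pseudogroups -/

section Pseudogroups

variable {M : Type u} [TopologicalSpace M]

/-- Quasi-pseudogroups: inverses and products exist locally. -/
def IsQuasiPseudogroup (P : Set (OpenPartialHomeomorph M M)) : Prop :=
  (∀ f ∈ P, ∀ x ∈ f.source, ∃ g ∈ P, ∃ U : Set M, IsOpen U ∧ x ∈ U ∧ U ⊆ f.source ∧
      f '' U ⊆ g.source ∧ ∀ y ∈ U, g (f y) = y) ∧
    ∀ f ∈ P, ∀ g ∈ P, ∀ x ∈ f.source, f x ∈ g.source → ∃ h ∈ P, x ∈ h.source ∧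
      ∃ U : Set M, IsOpen U ∧ x ∈ U ∧ U ⊆ f.source ∩ f ⁻¹' g.source ∩ h.source ∧
        ∀ y ∈ U, g (f y) = h y

/-- The set `A` is generated by `B`: `B ⊆ A`, and the elements of `A` agree locally with elements
of `B`. -/
def IsGeneratedBy (A B : Set (OpenPartialHomeomorph M M)) : Prop :=
  B ⊆ A ∧ ∀ f ∈ A, ∀ x ∈ f.source, ∃ g ∈ B, x ∈ g.source ∧
    ∃ U : Set M, IsOpen U ∧ x ∈ U ∧ U ⊆ f.source ∩ g.source ∧ ∀ y ∈ U, f y = g y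

end Pseudogroups

/-! ### Charted orbifold maps -/

section Maps

variable {n n' n'' : ℕ} {Q Q' Q'' : Type u} [TopologicalSpace Q] [TopologicalSpace Q']
  [TopologicalSpace Q'']

/-- `g` is a local lift of `f` with respect to the charts `C` and `D`. -/
def IsLocalLift (f : Q → Q') (C : OrbifoldChart n Q) (D : OrbifoldChart n' Q')
    (g : C.carrier → D.carrier) : Prop :=
  ContMDiff (𝓡 n) (𝓡 n') ∞ g ∧ ∀ x, D.proj (g x) = f (C.proj x)

/-- A continuous map `f : Q → Q'` together with, for each chart `C` of `V`, a local lift of `f`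
with respect to `C` and some chart `idx C` of `V'`. -/
structure LiftFamily (V : OrbifoldAtlas n Q) (V' : OrbifoldAtlas n' Q') where
  f : Q → Q'
  continuous_f : Continuous f
  idx : V.charts → V'.charts
  lift : ∀ C : V.charts, C.1.carrier → (idx C).1.carrier
  isLocalLift : ∀ C, IsLocalLift f C.1 (idx C).1 (lift C)

/-- The disjoint union `ψ` of the local lifts. -/
def LiftFamily.total {V : OrbifoldAtlas n Q} {V' : OrbifoldAtlas n' Q'} (r : LiftFamily V V')
    (p : V.Total) : V'.Total :=
  ⟨r.idx p.1, r.lift p.1 p.2⟩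

/-- A representative `(f, {lift C}, P, ν)` of an orbifold map with domain atlas `V` and range
family contained in the atlas `V'`. Two partial maps which are defined at a point `x` have the same
germ at `x` if and only if they are equal eventually along `𝓝 x`. -/
structure OrbMapRep (V : OrbifoldAtlas n Q) (V' : OrbifoldAtlas n' Q')
    extends LiftFamily V V' where
  P : Set (OpenPartialHomeomorph V.Total V.Total)
  isChangeOfCharts : ∀ a ∈ P, V.IsChangeOfCharts a
  isQuasiPseudogroup : IsQuasiPseudogroup P
  isGeneratedBy : IsGeneratedBy V.Psi P
  ν : P → OpenPartialHomeomorph V'.Total V'.Total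
  isChartEmbedding : ∀ a, V'.IsChartEmbedding (ν a)
  mem_source : ∀ (a : P), ∀ x ∈ a.1.source, toLiftFamily.total x ∈ (ν a).source
  equivariant : ∀ (a : P), ∀ x ∈ a.1.source,
    toLiftFamily.total (a.1 x) = ν a (toLiftFamily.total x)
  germ_congr : ∀ (a b : P) (x : V.Total), x ∈ a.1.source → x ∈ b.1.source →
    a.1 =ᶠ[𝓝 x] b.1 → ν a =ᶠ[𝓝 (toLiftFamily.total x)] ν b
  germ_mul : ∀ (a b c : P) (x : V.Total), x ∈ a.1.source → a.1 x ∈ b.1.source → x ∈ c.1.source →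
    (fun y => b.1 (a.1 y)) =ᶠ[𝓝 x] c.1 →
      (fun y => ν b (ν a y)) =ᶠ[𝓝 (toLiftFamily.total x)] ν c
  germ_one : ∀ (a : P) (x : V.Total), x ∈ a.1.source → a.1 =ᶠ[𝓝 x] id →
    ν a =ᶠ[𝓝 (toLiftFamily.total x)] id

namespace OrbMapRep

variable {V : OrbifoldAtlas n Q} {V' : OrbifoldAtlas n' Q'} {V'' : OrbifoldAtlas n'' Q''}

/-- Equivalence of representatives of orbifold maps: the same continuous map, the same local lifts,
and the same germs assigned to equal germs. -/
def Equivalent (r s : OrbMapRep V V') : Prop :=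
  r.toLiftFamily = s.toLiftFamily ∧
    ∀ (a : r.P) (b : s.P) (x : V.Total), x ∈ a.1.source → x ∈ b.1.source →
      a.1 =ᶠ[𝓝 x] b.1 → r.ν a =ᶠ[𝓝 (r.total x)] s.ν b

theorem exists_germ (r : OrbMapRep V V') {f : OpenPartialHomeomorph V.Total V.Total}
    (hf : f ∈ V.Psi) {x : V.Total} (hx : x ∈ f.source) :
    ∃ a : r.P, x ∈ a.1.source ∧ f =ᶠ[𝓝 x] a.1 := by
  obtain ⟨g, hg, hxg, W, hW, hxW, -, h⟩ := r.isGeneratedBy.2 f hf x hx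
  exact ⟨⟨g, hg⟩, hxg, eventually_of_mem (hW.mem_nhds hxW) h⟩

theorem equivalence (V : OrbifoldAtlas n Q) (V' : OrbifoldAtlas n' Q') :
    Equivalence (Equivalent (V := V) (V' := V')) where
  refl r := ⟨rfl, r.germ_congr⟩
  symm {r s} h := ⟨h.1.symm, fun a b x hxa hxb hab => by
    rw [← h.1]; exact (h.2 b a x hxb hxa hab.symm).symm⟩
  trans {r s t} h k := ⟨h.1.trans k.1, fun a c x hxa hxc hac => by
    obtain ⟨b, hxb, hb⟩ := s.exists_germ (r.isChangeOfCharts _ a.2).1 hxa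
    have h2 := k.2 b c x hxb hxc (hb.symm.trans hac)
    rw [← h.1] at h2
    exact (h.2 a b x hxa hxb hb).trans h2⟩

instance setoid (V : OrbifoldAtlas n Q) (V' : OrbifoldAtlas n' Q') : Setoid (OrbMapRep V V') :=
  ⟨Equivalent, equivalence V V'⟩

end OrbMapRep

/-- The set `Orbmap(V, V')` of charted orbifold maps with `(V, V')`: the equivalence classes
`(f, {lift C}, [P, ν])` of representatives. -/
def OrbMap (V : OrbifoldAtlas n Q) (V' : OrbifoldAtlas n' Q') : Type _ :=
  Quotient (OrbMapRep.setoid V V')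

/-- The continuous map and the local lifts of a charted orbifold map. -/
def OrbMap.liftFamily {V : OrbifoldAtlas n Q} {V' : OrbifoldAtlas n' Q'} (φ : OrbMap V V') :
    LiftFamily V V' :=
  Quotient.lift (fun r : OrbMapRep V V' => r.toLiftFamily)
    (fun r s (h : r.Equivalent s) => h.1) φ

/-! ### Composition of charted orbifold maps -/

section Composition

variable {V : OrbifoldAtlas n Q} {V' : OrbifoldAtlas n' Q'} {V'' : OrbifoldAtlas n'' Q''}

theorem LiftFamily.continuous_total (r : LiftFamily V V') : Continuous r.total :=
  continuous_sigma fun C =>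
    (continuous_sigmaMk (σ := fun D : V'.charts => D.1.carrier) (i := r.idx C)).comp
      (r.isLocalLift C).1.continuous

/-- The composition of continuous maps with local lifts. -/
def LiftFamily.comp (s : LiftFamily V' V'') (r : LiftFamily V V') : LiftFamily V V'' where
  f := s.f ∘ r.f
  continuous_f := s.continuous_f.comp r.continuous_f
  idx := s.idx ∘ r.idx
  lift C := s.lift (r.idx C) ∘ r.lift C
  isLocalLift C := ⟨(s.isLocalLift _).1.comp (r.isLocalLift C).1, fun x => by
    simp only [Function.comp_apply]
    rw [(s.isLocalLift (r.idx C)).2 (r.lift C x), (r.isLocalLift C).2 x]⟩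

theorem isTransition_restrOpen {f : OpenPartialHomeomorph V.Total V.Total}
    (hf : IsTransition (n := n) f) {s : Set V.Total} (hs : IsOpen s) :
    IsTransition (n := n) (f.restrOpen s hs) := by
  refine ⟨hf.1.mono fun x hx => ?_, hf.2.mono fun x hx => ?_⟩
  · rw [OpenPartialHomeomorph.restrOpen_source] at hx
    exact hx.1
  · have := (f.restrOpen s hs).map_target hx
    rw [OpenPartialHomeomorph.restrOpen_source] at this
    have h2 : f ((f.restrOpen s hs).symm x) = x := (f.restrOpen s hs).right_inv hx
    rw [← h2]
    exact f.map_source this.1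

theorem mem_Psi_symm {f : OpenPartialHomeomorph V.Total V.Total} (hf : f ∈ V.Psi) :
    f.symm ∈ V.Psi := by
  refine ⟨⟨hf.1.2, by simpa using hf.1.1⟩, fun p hp => ?_⟩
  have h := hf.2 (f.symm p) (f.map_target hp)
  rw [f.right_inv hp] at h
  exact h.symm

theorem mem_Psi_trans {f g : OpenPartialHomeomorph V.Total V.Total} (hf : f ∈ V.Psi)
    (hg : g ∈ V.Psi) : f.trans g ∈ V.Psi := by
  refine ⟨⟨?_, ?_⟩, fun p hp => ?_⟩
  · refine hg.1.1.comp (hf.1.1.mono fun x hx => ?_) fun x hx => ?_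
    · rw [OpenPartialHomeomorph.trans_source] at hx; exact hx.1
    · rw [OpenPartialHomeomorph.trans_source] at hx; exact hx.2
  · refine hf.1.2.comp (hg.1.2.mono fun x hx => ?_) fun x hx => ?_
    · rw [OpenPartialHomeomorph.trans_target] at hx; exact hx.1
    · rw [OpenPartialHomeomorph.trans_target] at hx; exact hx.2
  · rw [OpenPartialHomeomorph.trans_source] at hp
    exact (hg.2 _ hp.2).trans (hf.2 p hp.1)

/-- A generating subset of `Ψ(V)` is a quasi-pseudogroup. -/
theorem IsGeneratedBy.isQuasiPseudogroup {P : Set (OpenPartialHomeomorph V.Total V.Total)}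
    (hP : IsGeneratedBy V.Psi P) : IsQuasiPseudogroup P := by
  refine ⟨fun f hf x hx => ?_, fun f hf g hg x hx hfx => ?_⟩
  · obtain ⟨g, hg, -, W, hW, hxW, hWs, h⟩ :=
      hP.2 f.symm (mem_Psi_symm (hP.1 hf)) (f x) (f.map_source hx)
    refine ⟨g, hg, f.source ∩ f ⁻¹' W, f.isOpen_inter_preimage hW, ⟨hx, hxW⟩,
      inter_subset_left, ?_, fun y hy => ?_⟩
    · rintro _ ⟨y, hy, rfl⟩
      exact (hWs hy.2).2
    · rw [← h _ hy.2, f.left_inv hy.1]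
  · obtain ⟨h, hh, hxh, W, hW, hxW, hWs, e⟩ :=
      hP.2 (f.trans g) (mem_Psi_trans (hP.1 hf) (hP.1 hg)) x
        (by rw [OpenPartialHomeomorph.trans_source]; exact ⟨hx, hfx⟩)
    refine ⟨h, hh, hxh, W, hW, hxW, fun y hy => ?_, e⟩
    have := hWs hy
    rw [OpenPartialHomeomorph.trans_source] at this
    exact this

namespace OrbMapRep

/-- `(a, b)` with `a ∈ P_r`, `b ∈ P_s` controls the change of charts `c`: on its domain, `c` agrees
with `a`, and there the germs of `ν_r(a)` along `ψ` are germs of `b`. -/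
def Controls (s : OrbMapRep V' V'') (r : OrbMapRep V V')
    (c : OpenPartialHomeomorph V.Total V.Total) (a : r.P) (b : s.P) : Prop :=
  ∀ x ∈ c.source, x ∈ a.1.source ∧ c x = a.1 x ∧ r.total x ∈ b.1.source ∧
    b.1 =ᶠ[𝓝 (r.total x)] r.ν a

/-- The quasi-pseudogroup of the composition: all changes of charts which are so small that
`ν_s` can be applied to `ν_r(a)` near the image of the domain. -/
def compP (s : OrbMapRep V' V'') (r : OrbMapRep V V') :
    Set (OpenPartialHomeomorph V.Total V.Total) :=
  {c | V.IsChangeOfCharts c ∧ ∃ a b, Controls s r c a b}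

/-- `ν(c) = ν_s(b)` for a choice of `(a, b)`. -/
noncomputable def compν (s : OrbMapRep V' V'') (r : OrbMapRep V V') (c : compP s r) :
    OpenPartialHomeomorph V''.Total V''.Total :=
  s.ν c.2.2.choose_spec.choose

theorem compν_spec (s : OrbMapRep V' V'') (r : OrbMapRep V V') (c : compP s r) :
    ∃ a b, Controls s r c.1 a b ∧ compν s r c = s.ν b :=
  ⟨_, _, c.2.2.choose_spec.choose_spec, rfl⟩

theorem Controls.eventuallyEq {s : OrbMapRep V' V''} {r : OrbMapRep V V'}
    {c : OpenPartialHomeomorph V.Total V.Total} {a : r.P} {b : s.P} (h : Controls s r c a b)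
    {x : V.Total} (hx : x ∈ c.source) : c =ᶠ[𝓝 x] a.1 :=
  eventually_of_mem (c.open_source.mem_nhds hx) fun y hy => (h y hy).2.1

theorem compP_generates (s : OrbMapRep V' V'') (r : OrbMapRep V V') :
    IsGeneratedBy V.Psi (compP s r) := by
  refine ⟨fun c hc => hc.1.1, fun f hf x hx => ?_⟩
  obtain ⟨a, ha, hfa⟩ := r.exists_germ hf hx
  obtain ⟨b, hb, hab⟩ := s.exists_germ (r.isChartEmbedding a).1 (r.mem_source a x ha)
  obtain ⟨W, hW, hWo, hxW⟩ := eventually_nhds_iff.1 (hab.and (b.1.open_source.mem_nhds hb))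
  obtain ⟨W₀, hW₀, hW₀o, hxW₀⟩ := eventually_nhds_iff.1 hfa
  have hopen : IsOpen (W₀ ∩ (r.total ⁻¹' W)) :=
    hW₀o.inter (hWo.preimage r.continuous_total)
  have hsrc := a.1.restrOpen_source _ hopen
  refine ⟨a.1.restrOpen _ hopen, ⟨⟨⟨isTransition_restrOpen (r.isChangeOfCharts _ a.2).1.1 hopen,
    fun p hp => ?_⟩, ?_⟩, a, b, fun y hy => ?_⟩, ?_, f.source ∩ (a.1.restrOpen _ hopen).source,
    f.open_source.inter (a.1.restrOpen _ hopen).open_source, ⟨hx, ?_⟩, subset_rfl, fun y hy => ?_⟩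
  · rw [hsrc] at hp
    exact (r.isChangeOfCharts _ a.2).1.2 p hp.1
  · obtain ⟨C, D, hC, hD⟩ := (r.isChangeOfCharts _ a.2).2
    refine ⟨C, D, ?_, ?_⟩
    · rw [hsrc]; exact inter_subset_left.trans hC
    · intro y hy
      have h1 := (a.1.restrOpen _ hopen).map_target hy
      rw [hsrc] at h1
      have h2 : a.1 ((a.1.restrOpen _ hopen).symm y) = y := (a.1.restrOpen _ hopen).right_inv hy
      rw [← h2]
      exact hD (a.1.map_source h1.1)
  · rw [hsrc] at hy
    exact ⟨hy.1, rfl, (hW _ hy.2.2).2, eventually_of_mem (hWo.mem_nhds hy.2.2)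
      fun z hz => ((hW z hz).1).symm⟩
  · rw [hsrc]; exact ⟨ha, hxW₀, hxW⟩
  · rw [hsrc]; exact ⟨ha, hxW₀, hxW⟩
  · rw [hsrc] at hy
    exact hW₀ y hy.2.2.1

theorem tendsto_ν (r : OrbMapRep V V') (a : r.P) {x : V.Total} (hx : x ∈ a.1.source) :
    Tendsto (r.ν a) (𝓝 (r.total x)) (𝓝 (r.total (a.1 x))) := by
  rw [r.equivariant a x hx]
  exact (r.ν a).continuousAt (r.mem_source a x hx)

/-- The representative `(P_h, ν_h)` of the composition. -/
noncomputable def comp (s : OrbMapRep V' V'') (r : OrbMapRep V V') : OrbMapRep V V'' where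
  toLiftFamily := s.toLiftFamily.comp r.toLiftFamily
  P := compP s r
  isChangeOfCharts _ hc := hc.1
  isQuasiPseudogroup := (compP_generates s r).isQuasiPseudogroup
  isGeneratedBy := compP_generates s r
  ν := compν s r
  isChartEmbedding c := by
    obtain ⟨a, b, -, h⟩ := compν_spec s r c
    rw [h]; exact s.isChartEmbedding b
  mem_source c x hx := by
    obtain ⟨a, b, hc, h⟩ := compν_spec s r c
    rw [h]; exact s.mem_source b _ (hc x hx).2.2.1
  equivariant c x hx := by
    obtain ⟨a, b, hc, h⟩ := compν_spec s r c
    obtain ⟨h1, h2, h3, h4⟩ := hc x hx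
    rw [h]
    change s.total (r.total (c.1 x)) = s.ν b (s.total (r.total x))
    rw [h2, r.equivariant a x h1, ← s.equivariant b _ h3, h4.eq_of_nhds]
  germ_congr c d x hxc hxd hcd := by
    obtain ⟨a, b, hc, h⟩ := compν_spec s r c
    obtain ⟨a', b', hd, h'⟩ := compν_spec s r d
    rw [h, h']
    have h1 := hc x hxc
    have h2 := hd x hxd
    have e := r.germ_congr a a' x h1.1 h2.1
      ((hc.eventuallyEq hxc).symm.trans (hcd.trans (hd.eventuallyEq hxd)))
    exact s.germ_congr b b' _ h1.2.2.1 h2.2.2.1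
      (h1.2.2.2.trans (e.trans h2.2.2.2.symm))
  germ_mul c₁ c₂ c₃ x hx1 hx2 hx3 hc := by
    obtain ⟨a₁, b₁, k₁, h₁⟩ := compν_spec s r c₁
    obtain ⟨a₂, b₂, k₂, h₂⟩ := compν_spec s r c₂
    obtain ⟨a₃, b₃, k₃, h₃⟩ := compν_spec s r c₃
    rw [h₁, h₂, h₃]
    obtain ⟨p1, p2, p3, p4⟩ := k₁ x hx1
    obtain ⟨q1, q2, q3, q4⟩ := k₂ _ hx2
    obtain ⟨t1, t2, t3, t4⟩ := k₃ x hx3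
    rw [p2] at q1 q3 q4
    have e1 : (fun y => a₂.1 (a₁.1 y)) =ᶠ[𝓝 x] a₃.1 := by
      refine EventuallyEq.trans ?_ (hc.trans (k₃.eventuallyEq hx3))
      have g1 := k₁.eventuallyEq hx1
      have g2 := (c₁.1.continuousAt hx1).eventually (k₂.eventuallyEq hx2)
      filter_upwards [g1, g2] with y hy1 hy2
      rw [hy2, hy1]
    have e2 := r.germ_mul a₁ a₂ a₃ x p1 q1 t1 e1
    refine s.germ_mul b₁ b₂ b₃ (r.total x) p3 ?_ t3 ?_
    · rw [p4.eq_of_nhds, ← r.equivariant a₁ x p1]; exact q3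
    · have g2 := (r.tendsto_ν a₁ p1).eventually q4
      filter_upwards [p4, g2, t4, e2] with y y1 y2 y3 y4
      rw [y1, y2, y3, y4]
  germ_one c x hx hc := by
    obtain ⟨a, b, k, h⟩ := compν_spec s r c
    rw [h]
    obtain ⟨p1, p2, p3, p4⟩ := k x hx
    exact s.germ_one b _ p3 (p4.trans (r.germ_one a x p1 ((k.eventuallyEq hx).symm.trans hc)))

theorem comp_equivalent {s s' : OrbMapRep V' V''} {r r' : OrbMapRep V V'} (hs : s.Equivalent s')
    (hr : r.Equivalent r') : (comp s r).Equivalent (comp s' r') := by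
  refine ⟨?_, fun c d x hxc hxd hcd => ?_⟩
  · change s.toLiftFamily.comp r.toLiftFamily = s'.toLiftFamily.comp r'.toLiftFamily
    rw [hs.1, hr.1]
  · obtain ⟨a, b, hc, h⟩ := compν_spec s r c
    obtain ⟨a', b', hd, h'⟩ := compν_spec s' r' d
    change compν s r c =ᶠ[𝓝 (s.total (r.total x))] compν s' r' d
    rw [h, h']
    have h1 := hc x hxc
    have h2 := hd x hxd
    rw [← hr.1] at h2
    have e := hr.2 a a' x h1.1 h2.1
      ((hc.eventuallyEq hxc).symm.trans (hcd.trans (hd.eventuallyEq hxd)))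
    exact hs.2 b b' _ h1.2.2.1 h2.2.2.1 (h1.2.2.2.trans (e.trans h2.2.2.2.symm))

end OrbMapRep

/-- The composition of charted orbifold maps. -/
noncomputable def OrbMap.comp (χ : OrbMap V' V'') (φ : OrbMap V V') : OrbMap V V'' :=
  Quotient.map₂ OrbMapRep.comp (fun _ _ hs _ _ hr => OrbMapRep.comp_equivalent hs hr) χ φ

end Composition

/-! ### Lifts of the identity and equivalence of charted orbifold maps -/

/-- The underlying map is the identity of `Q` and all local lifts are local diffeomorphisms. -/
def OrbMap.IsLiftOfId {V V' : OrbifoldAtlas n Q} (φ : OrbMap V V') : Prop :=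
  φ.liftFamily.f = id ∧
    ∀ C : V.charts, IsLocalDiffeomorph (𝓡 n) (𝓡 n) ∞ (φ.liftFamily.lift C)

end Maps

/-- A charted orbifold map from `Q` to `Q'`, with arbitrary domain atlas and range atlas. -/
structure ChartedOrbMap (n : ℕ) (Q : Type u) [TopologicalSpace Q]
    (n' : ℕ) (Q' : Type u) [TopologicalSpace Q'] where
  dom : OrbifoldAtlas n Q
  cod : OrbifoldAtlas n' Q'
  map : OrbMap dom cod

section Equivalence

variable {n n' : ℕ} {Q Q' : Type u} [TopologicalSpace Q] [TopologicalSpace Q']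

/-- Two charted orbifold maps between the same orbifolds `(Q, U)` and `(Q', U')` are equivalent if
they induce the same charted orbifold map `h` on common refinements `W`, `W'` of the atlases. -/
def ChartedOrbMap.Equivalent (φ₁ φ₂ : ChartedOrbMap n Q n' Q') : Prop :=
  ∃ (U : OrbifoldStructure n Q) (U' : OrbifoldStructure n' Q'),
    φ₁.dom.IsRepresentative U ∧ φ₂.dom.IsRepresentative U ∧
    φ₁.cod.IsRepresentative U' ∧ φ₂.cod.IsRepresentative U' ∧
    ∃ (W : OrbifoldAtlas n Q) (W' : OrbifoldAtlas n' Q'),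
      W.IsRepresentative U ∧ W'.IsRepresentative U' ∧
      ∃ (ε₁ : OrbMap W φ₁.dom) (ε₂ : OrbMap W φ₂.dom)
        (ε₁' : OrbMap W' φ₁.cod) (ε₂' : OrbMap W' φ₂.cod) (h : OrbMap W W'),
        ε₁.IsLiftOfId ∧ ε₂.IsLiftOfId ∧ ε₁'.IsLiftOfId ∧ ε₂'.IsLiftOfId ∧
        φ₁.map.comp ε₁ = ε₁'.comp h ∧ φ₂.map.comp ε₂ = ε₂'.comp h

/-- The equivalence class `[φ]`. -/
def ChartedOrbMap.equivClass (φ : ChartedOrbMap n Q n' Q') : Set (ChartedOrbMap n Q n' Q') :=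
  {χ | φ.Equivalent χ}

/-- The set of all lifts of the identity of `(Q, U)`: charted orbifold maps whose domain atlas
represents `U`, whose underlying map is the identity and whose local lifts are local
diffeomorphisms. -/
def liftsOfId (U : OrbifoldStructure n Q) : Set (ChartedOrbMap n Q n Q) :=
  {φ | φ.dom.IsRepresentative U ∧ φ.map.IsLiftOfId}

end Equivalence

end ReducedOrbifold

/-! The disjoint union ψ of the local lifts of a lift of the identity is a local diffeomorphism,
hence open. The equation ψ ∘ λ = ν(λ) ∘ ψ then determines every germ of ν(λ). So such a map is
determined by its family of lifts (`OrbMap.ext_of_isOpenMap`), and the germ axioms for ν follow from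
equivariance (`exists_orbMap_of_isEmbedding`).

Two lifts φ, χ of the identity are equivalent: small charts that embed into charts of both domain
atlases form an atlas W, and the embeddings give lifts ε₁, ε₂ of the identity from W. Now W' = W, h
the identity of W, ε₁' = φ ∘ ε₁ and ε₂' = χ ∘ ε₂ witness the equivalence. That W exists rests on
`OrbifoldChart.exists_stable_nhd`: each point has arbitrarily small connected open neighbourhoods to
which the chart restricts as a chart, and by maximality (`OrbifoldStructure.mem_of_related`) this
restriction lies in the structure.

Conversely, let φ be a lift of the identity with φ ∘ ε₁ = ε₁' ∘ h and χ ∘ ε₂ = ε₂' ∘ h. Cancelling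
ε₁' in the first equation shows that h lies over the identity and has locally diffeomorphic lifts.
Cancelling ε₂ in the second shows that χ lies over the identity and is locally diffeomorphic at the
points in the image of ε₂. That image need not be everything, but it meets every fibre of the
projection, and equivariance under Ψ carries the property along fibres
(`OrbMap.locDiffAt_total_of_proj_eq`). -/

namespace ReducedOrbifold

/-! ### Calculus of local diffeomorphisms -/

section LocalDiffeomorphisms

variable {n : ℕ} {M N K : Type*} [TopologicalSpace M] [TopologicalSpace N] [TopologicalSpace K]
  [ChartedSpace (EuclideanSpace ℝ (Fin n)) M] [ChartedSpace (EuclideanSpace ℝ (Fin n)) N]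
  [ChartedSpace (EuclideanSpace ℝ (Fin n)) K]

/-- Smooth local diffeomorphisms at a point between `n`-manifolds without boundary. -/
abbrev LocDiffAt (n : ℕ) {M N : Type*} [TopologicalSpace M] [TopologicalSpace N]
    [ChartedSpace (EuclideanSpace ℝ (Fin n)) M] [ChartedSpace (EuclideanSpace ℝ (Fin n)) N]
    (f : M → N) (x : M) : Prop :=
  IsLocalDiffeomorphAt (𝓡 n) (𝓡 n) ∞ f x

theorem locDiffAt_of_contMDiffOn {h : OpenPartialHomeomorph M N}
    (h1 : ContMDiffOn (𝓡 n) (𝓡 n) ∞ h h.source)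
    (h2 : ContMDiffOn (𝓡 n) (𝓡 n) ∞ h.symm h.target) {x : M} (hx : x ∈ h.source) :
    LocDiffAt n h x :=
  ⟨⟨h.toPartialEquiv, h.open_source, h.open_target, h1, h2⟩, hx, fun _ _ => rfl⟩

/-- A local diffeomorphism restricts to a diffeomorphism between open subsets, with source in a
given neighbourhood. -/
theorem LocDiffAt.exists_openPartialHomeomorph {f : M → N} {x : M} (hf : LocDiffAt n f x)
    {O : Set M} (hO : O ∈ 𝓝 x) :
    ∃ h : OpenPartialHomeomorph M N, ContMDiffOn (𝓡 n) (𝓡 n) ∞ h h.source ∧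
      ContMDiffOn (𝓡 n) (𝓡 n) ∞ h.symm h.target ∧ x ∈ h.source ∧ h.source ⊆ O ∧
      EqOn f h h.source := by
  obtain ⟨Φ, hx, hΦ⟩ := hf
  have hsrc := Φ.toOpenPartialHomeomorph.restr_source O
  have htgt : (Φ.toOpenPartialHomeomorph.restr O).target ⊆ Φ.target := fun y hy => hy.1
  refine ⟨Φ.toOpenPartialHomeomorph.restr O, Φ.contMDiffOn_toFun.mono ?_,
    Φ.contMDiffOn_invFun.mono htgt, ?_, ?_, ?_⟩
  · rw [hsrc]; exact inter_subset_left
  · rw [hsrc]; exact ⟨hx, mem_interior_iff_mem_nhds.2 hO⟩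
  · rw [hsrc]; exact inter_subset_right.trans interior_subset
  · rw [hsrc]; exact hΦ.mono inter_subset_left

/-- The partial diffeomorphism that represents `f`, shrunk to the set where the two maps agree,
represents `g` too. -/
theorem LocDiffAt.congr {f g : M → N} {x : M} (hf : LocDiffAt n f x) (h : f =ᶠ[𝓝 x] g) :
    LocDiffAt n g x := by
  obtain ⟨Φ, h1, h2, hx, hO, he⟩ := hf.exists_openPartialHomeomorph h
  exact ⟨⟨Φ.toPartialEquiv, Φ.open_source, Φ.open_target, h1, h2⟩, hx,
    fun y hy => (hO hy).symm.trans (he hy)⟩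

theorem LocDiffAt.continuousAt {f : M → N} {x : M} (hf : LocDiffAt n f x) : ContinuousAt f x :=
  (IsLocalDiffeomorphAt.contMDiffAt hf).continuousAt

/-- A local diffeomorphism has a local inverse that is a local diffeomorphism. -/
theorem LocDiffAt.exists_inverse {f : M → N} {x : M} (hf : LocDiffAt n f x) :
    ∃ g : N → M, LocDiffAt n g (f x) ∧ g (f x) = x ∧ (∀ᶠ y in 𝓝 x, g (f y) = y) ∧
      ∀ᶠ z in 𝓝 (f x), f (g z) = z := by
  obtain ⟨Φ, h1, h2, hx, -, he⟩ := hf.exists_openPartialHomeomorph univ_mem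
  have hfx : f x ∈ Φ.target := by rw [he hx]; exact Φ.map_source hx
  refine ⟨Φ.symm, locDiffAt_of_contMDiffOn (h := Φ.symm) h2 (by simpa using h1) hfx, ?_, ?_, ?_⟩
  · rw [he hx, Φ.left_inv hx]
  · filter_upwards [Φ.open_source.mem_nhds hx] with y hy
    rw [he hy, Φ.left_inv hy]
  · filter_upwards [Φ.open_target.mem_nhds hfx] with z hz
    rw [he (Φ.map_target hz), Φ.right_inv hz]

theorem LocDiffAt.comp {g : N → K} {f : M → N} {x : M} (hg : LocDiffAt n g (f x))
    (hf : LocDiffAt n f x) : LocDiffAt n (g ∘ f) x :=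
  IsLocalDiffeomorphAt.comp (hf := hf) (hg := hg)

/-- Cancellation on the left. -/
theorem LocDiffAt.of_comp_left {g : N → K} {f : M → N} {x : M} (hg : LocDiffAt n g (f x))
    (hf : ContinuousAt f x) (hgf : LocDiffAt n (g ∘ f) x) : LocDiffAt n f x := by
  obtain ⟨k, hk, -, hkg, -⟩ := hg.exists_inverse
  exact (LocDiffAt.comp (f := g ∘ f) hk hgf).congr (hf.eventually hkg)

/-- Cancellation on the right. -/
theorem LocDiffAt.of_comp_right {g : N → K} {f : M → N} {x : M} (hf : LocDiffAt n f x)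
    (hgf : LocDiffAt n (g ∘ f) x) : LocDiffAt n g (f x) := by
  obtain ⟨k, hk, hkx, -, hfk⟩ := hf.exists_inverse
  refine (LocDiffAt.comp (g := g ∘ f) (f := k) (x := f x) (by rwa [hkx]) hk).congr ?_
  filter_upwards [hfk] with z hz
  simp only [Function.comp_apply, hz]

/-- A smooth open embedding with smooth local inverses is a local diffeomorphism. -/
theorem locDiffAt_of_isOpenEmbedding {j : M → N} (hj : IsOpenEmbedding j)
    (h1 : ContMDiff (𝓡 n) (𝓡 n) ∞ j)
    (h2 : ∀ (k : N → M) (x : M), (∀ y, k (j y) = y) → ContinuousAt k (j x) →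
      ContMDiffAt (𝓡 n) (𝓡 n) ∞ k (j x)) (x : M) : LocDiffAt n j x := by
  have : Nonempty M := ⟨x⟩
  refine (locDiffAt_of_contMDiffOn (h := hj.toOpenPartialHomeomorph j) h1.contMDiffOn ?_
    (mem_univ x))
  intro y hy
  obtain ⟨z, rfl⟩ : y ∈ range j := by simpa using hy
  exact (h2 _ z (fun w => hj.toOpenPartialHomeomorph_left_inv j)
    ((hj.toOpenPartialHomeomorph j).continuousAt_symm hy)).contMDiffWithinAt

theorem locDiffAt_subtype_val (S : TopologicalSpace.Opens M) (x : S) :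
    LocDiffAt n (Subtype.val : S → M) x := by
  refine locDiffAt_of_isOpenEmbedding (M := S) S.2.isOpenEmbedding_subtypeVal
    contMDiff_subtype_val ?_ x
  intro k x hk _
  -- A map into an open subset is as smooth as its composite with the inclusion, and here that
  -- composite is the identity near `x`.
  refine (ContMDiffAt.subtypeVal_comp_iff S k x.1).1 (contMDiffAt_id.congr_of_eventuallyEq ?_)
  filter_upwards [S.2.mem_nhds x.2] with y hy
  exact congrArg Subtype.val (hk ⟨y, hy⟩)

theorem isOpenMap_of_locDiffAt {f : M → N} (hf : ∀ x, LocDiffAt n f x) : IsOpenMap f :=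
  IsLocalDiffeomorph.isOpenMap (I := 𝓡 n) (J := 𝓡 n) (n := ∞) hf

end LocalDiffeomorphisms

/-- Smoothness of the inverse comes for free: cancel `f` on the right in `f.symm ∘ f = id`.
Membership in Ψ thereby becomes a pointwise condition that can be handled by cancellation. -/
theorem isTransition_iff_locDiffAt {n : ℕ} {M N : Type u} [TopologicalSpace M]
    [TopologicalSpace N] [ChartedSpace (EuclideanSpace ℝ (Fin n)) M]
    [ChartedSpace (EuclideanSpace ℝ (Fin n)) N] {f : OpenPartialHomeomorph M N} :
    IsTransition (n := n) f ↔ ∀ x ∈ f.source, LocDiffAt n f x := by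
  refine ⟨fun h x hx => locDiffAt_of_contMDiffOn h.1 h.2 hx, fun h =>
    ⟨fun x hx => (IsLocalDiffeomorphAt.contMDiffAt (h x hx)).contMDiffWithinAt, fun y hy => ?_⟩⟩
  have hx := f.map_target hy
  have h1 : LocDiffAt n f.symm (f (f.symm y)) := by
    refine LocDiffAt.of_comp_right (h _ hx) (LocDiffAt.congr (f := id) ?_ ?_)
    · exact (Diffeomorph.refl (𝓡 n) M ∞).isLocalDiffeomorph _
    · filter_upwards [f.open_source.mem_nhds hx] with z hz
      exact (f.left_inv hz).symm
  rw [f.right_inv hy] at h1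
  exact (IsLocalDiffeomorphAt.contMDiffAt h1).contMDiffWithinAt

/-! ### The smooth structure of the disjoint union of the charts -/

section Total

variable {n : ℕ} {Q : Type u} [TopologicalSpace Q] (V : OrbifoldAtlas n Q)

theorem isOpenEmbedding_mk (C : V.charts) :
    IsOpenEmbedding (fun x : C.1.carrier => (⟨C, x⟩ : V.Total)) :=
  IsOpenEmbedding.sigmaMk (σ := fun D : V.charts => D.1.carrier) (i := C)

theorem chartAt_mk_apply (C : V.charts) (x y : C.1.carrier) :
    chartAt (EuclideanSpace ℝ (Fin n)) (⟨C, x⟩ : V.Total) ⟨C, y⟩ =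
      chartAt (EuclideanSpace ℝ (Fin n)) x y :=
  OpenPartialHomeomorph.lift_openEmbedding_apply _ (isOpenEmbedding_mk V C)

theorem chartAt_mk_symm_apply (C : V.charts) (x : C.1.carrier) (z : EuclideanSpace ℝ (Fin n)) :
    (chartAt (EuclideanSpace ℝ (Fin n)) (⟨C, x⟩ : V.Total)).symm z =
      ⟨C, (chartAt (EuclideanSpace ℝ (Fin n)) x).symm z⟩ := rfl

theorem locDiffAt_mk (C : V.charts) (x : C.1.carrier) :
    LocDiffAt n (fun x : C.1.carrier => (⟨C, x⟩ : V.Total)) x := by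
  -- In the lifted charts the inclusion and its local inverses are both read as the identity on the
  -- chart target; this handles both at once.
  have key : ∀ (x : C.1.carrier) (f : EuclideanSpace ℝ (Fin n) → EuclideanSpace ℝ (Fin n)),
      (∀ z ∈ (chartAt (EuclideanSpace ℝ (Fin n)) x).target, f z = z) →
      ContDiffWithinAt ℝ ∞ f (range (𝓡 n)) (chartAt (EuclideanSpace ℝ (Fin n)) x x) := by
    intro x f hf
    have ht := (chartAt (EuclideanSpace ℝ (Fin n)) x).map_source (mem_chart_source _ x)
    refine ContDiffWithinAt.congr_of_eventuallyEq (f := id) contDiffWithinAt_id ?_ (hf _ ht)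
    filter_upwards [mem_nhdsWithin_of_mem_nhds
      ((chartAt (EuclideanSpace ℝ (Fin n)) x).open_target.mem_nhds ht)] with z hz
    exact hf z hz
  refine locDiffAt_of_isOpenEmbedding (isOpenEmbedding_mk V C) (fun x => ?_) ?_ x
  · rw [contMDiffAt_iff]
    refine ⟨(isOpenEmbedding_mk V C).continuous.continuousAt, key x _ fun z hz => ?_⟩
    simp only [mfld_simps, Function.comp_apply]
    rw [chartAt_mk_apply]
    exact (chartAt (EuclideanSpace ℝ (Fin n)) x).right_inv hz
  · intro k x hk hc
    rw [contMDiffAt_iff]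
    refine ⟨hc, ?_⟩
    have h := key x (extChartAt (𝓡 n) (k ⟨C, x⟩) ∘ k ∘ (extChartAt (𝓡 n) (⟨C, x⟩ : V.Total)).symm)
      fun z hz => by
        simp only [mfld_simps, Function.comp_apply]
        rw [chartAt_mk_symm_apply, hk, hk]
        exact (chartAt (EuclideanSpace ℝ (Fin n)) x).right_inv hz
    rw [← chartAt_mk_apply] at h
    exact h

end Total

/-! ### Germs of transitions between orbifold charts -/

section Related

variable {n : ℕ} {Q : Type u} [TopologicalSpace Q]

/-- The points `x` and `y` are related by a germ of a diffeomorphism which commutes with the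
projections. -/
def OrbifoldChart.Related (C D : OrbifoldChart n Q) (x : C.carrier) (y : D.carrier) : Prop :=
  ∃ f : C.carrier → D.carrier, LocDiffAt n f x ∧ f x = y ∧ ∀ᶠ z in 𝓝 x, D.proj (f z) = C.proj z

theorem OrbifoldChart.Related.proj_eq {C D : OrbifoldChart n Q} {x : C.carrier} {y : D.carrier}
    (h : C.Related D x y) : C.proj x = D.proj y := by
  obtain ⟨f, -, rfl, hf⟩ := h
  exact hf.self_of_nhds.symm

theorem OrbifoldChart.Related.symm {C D : OrbifoldChart n Q} {x : C.carrier} {y : D.carrier}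
    (h : C.Related D x y) : D.Related C y x := by
  obtain ⟨f, hf, rfl, hp⟩ := h
  obtain ⟨g, hg, hgx, -, hfg⟩ := hf.exists_inverse
  refine ⟨g, hg, hgx, ?_⟩
  have ht : Tendsto g (𝓝 (f x)) (𝓝 x) := by simpa [ContinuousAt, hgx] using hg.continuousAt
  filter_upwards [ht.eventually hp, hfg] with z h1 h2
  rw [← h1, h2]

theorem OrbifoldChart.Related.trans {C D E : OrbifoldChart n Q} {x : C.carrier} {y : D.carrier}
    {z : E.carrier} (h : C.Related D x y) (k : D.Related E y z) : C.Related E x z := by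
  obtain ⟨f, hf, rfl, hp⟩ := h
  obtain ⟨g, hg, rfl, hq⟩ := k
  refine ⟨g ∘ f, hg.comp hf, rfl, ?_⟩
  filter_upwards [hp, hf.continuousAt.eventually hq] with w h1 h2
  exact h2.trans h1

/-- A germ is enough, since a representative can be shrunk until it is injective and commutes with
the projections. In this form compatibility can be composed and inverted pointwise. -/
theorem OrbifoldChart.compatible_iff {C D : OrbifoldChart n Q} :
    C.Compatible D ↔ ∀ x y, C.proj x = D.proj y → C.Related D x y := by
  refine forall₃_congr fun x y _ => ⟨?_, ?_⟩
  · rintro ⟨h, ht, hx, hxy, hp⟩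
    exact ⟨h, isTransition_iff_locDiffAt.1 ht x hx, hxy,
      eventually_of_mem (h.open_source.mem_nhds hx) hp⟩
  · rintro ⟨f, hf, rfl, hp⟩
    obtain ⟨h, h1, h2, hx, hO, he⟩ := hf.exists_openPartialHomeomorph hp
    exact ⟨h, ⟨h1, h2⟩, hx, (he hx).symm, fun z hz => by rw [← he hz]; exact hO hz⟩

theorem OrbifoldStructure.related (U : OrbifoldStructure n Q) {C D : OrbifoldChart n Q}
    (hC : C ∈ U.charts) (hD : D ∈ U.charts) {x : C.carrier} {y : D.carrier}
    (h : C.proj x = D.proj y) : C.Related D x y :=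
  OrbifoldChart.compatible_iff.1 (U.compatible C hC D hD) x y h

/-- A chart belongs to the orbifold structure if it is locally related to charts of the
structure. -/
theorem OrbifoldStructure.mem_of_related (U : OrbifoldStructure n Q) {C : OrbifoldChart n Q}
    (h : ∀ x : C.carrier, ∃ D ∈ U.charts, ∃ y, C.Related D x y) : C ∈ U.charts := by
  -- Pass from `x` to some chart `D` of the structure, then use compatibility inside the structure.
  have key : ∀ E ∈ U.charts, ∀ x y, C.proj x = E.proj y → C.Related E x y := by
    intro E hE x y hxy
    obtain ⟨D, hD, z, hz⟩ := h x
    exact hz.trans (U.related hD hE (hz.proj_eq.symm.trans hxy))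
  have key' : ∀ x y, C.proj x = C.proj y → C.Related C x y := by
    intro x y hxy
    obtain ⟨D, hD, z, hz⟩ := h y
    exact (key D hD x z (hxy.trans hz.proj_eq)).trans hz.symm
  refine U.maximal ⟨insert C U.charts, ?_, ?_⟩ (subset_insert _ _) (mem_insert _ _)
  · rintro D (rfl | hD) E (rfl | hE)
    · exact OrbifoldChart.compatible_iff.2 key'
    · exact OrbifoldChart.compatible_iff.2 (key E hE)
    · exact OrbifoldChart.compatible_iff.2 fun x y hxy => (key D hD y x hxy.symm).symm
    · exact U.compatible D hD E hE
  · intro q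
    obtain ⟨D, hD, hq⟩ := U.covers q
    exact ⟨D, mem_insert_of_mem _ hD, hq⟩

/-- An atlas determines the orbifold structure that it represents. -/
theorem OrbifoldAtlas.IsRepresentative.subset {V : OrbifoldAtlas n Q} {U U' : OrbifoldStructure n Q}
    (h : V.IsRepresentative U) (h' : V.IsRepresentative U') : U'.charts ⊆ U.charts := by
  intro C hC
  refine U.mem_of_related fun x => ?_
  obtain ⟨D, hD, y, hy⟩ := V.covers (C.proj x)
  exact ⟨D, h hD, y, U'.related hC (h' hD) hy.symm⟩

theorem OrbifoldAtlas.IsRepresentative.subset_structureCharts {V : OrbifoldAtlas n Q}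
    {U : OrbifoldStructure n Q} (h : V.IsRepresentative U) : U.charts ⊆ V.structureCharts :=
  fun C hC D hD => U.compatible C hC D (h hD)

end Related

/-! ### Small orbifold charts -/

section Small

variable {n : ℕ} {Q : Type u} [TopologicalSpace Q]

/-- The saturation of an open set is the union of its translates under `G`, hence open; the quotient
topology and the openness of the range do the rest. -/
theorem OrbifoldChart.isOpenMap_proj (C : OrbifoldChart n Q) : IsOpenMap C.proj := by
  intro O hO
  have h1 : IsOpen ((Subtype.val : range C.proj → Q) ⁻¹' (C.proj '' O)) := by
    rw [← C.isQuotientMap.isOpen_preimage]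
    have h2 : rangeFactorization C.proj ⁻¹' ((Subtype.val : range C.proj → Q) ⁻¹' (C.proj '' O)) =
        ⋃ g ∈ C.G, g ⁻¹' O := by
      ext y
      simp only [mem_preimage, rangeFactorization_coe, mem_image, mem_iUnion, exists_prop]
      constructor
      · rintro ⟨x, hx, hxy⟩
        obtain ⟨g, hg, rfl⟩ := (C.proj_eq_iff y x).1 hxy.symm
        exact ⟨g, hg, hx⟩
      · rintro ⟨g, hg, hy⟩
        exact ⟨g y, hy, ((C.proj_eq_iff y (g y)).2 ⟨g, hg, rfl⟩).symm⟩
    rw [h2]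
    exact isOpen_biUnion fun g _ => hO.preimage g.continuous
  have h3 := C.isOpen_range.isOpenMap_subtype_val _ h1
  rwa [Subtype.image_preimage_coe, inter_eq_right.2 (image_subset_range _ _)] at h3

/-- Any neighbourhood of `x` contains an open connected neighbourhood of `x` which every element of
`G` either preserves or moves off itself. -/
theorem OrbifoldChart.exists_stable_nhd (C : OrbifoldChart n Q) (x : C.carrier)
    {O : Set C.carrier} (hO : O ∈ 𝓝 x) :
    ∃ S : TopologicalSpace.Opens C.carrier, x ∈ S ∧ (S : Set C.carrier) ⊆ O ∧
      IsConnected (S : Set C.carrier) ∧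
      ∀ g ∈ C.G, (∃ y ∈ S, g y ∈ S) → ∀ y ∈ S, g y ∈ S := by
  have := C.finite_G
  have : LocallyConnectedSpace C.carrier :=
    ChartedSpace.locallyConnectedSpace (EuclideanSpace ℝ (Fin n)) C.carrier
  -- If `g` moves `x`, the Hausdorff property gives a neighbourhood disjoint from its image under
  -- `g`. On the finite intersection `N` of these sets, only elements fixing `x` can send a point of
  -- `N` into `N`.
  have h1 : ∀ g : C.carrier ≃ₜ C.carrier, ∃ A : Set C.carrier, IsOpen A ∧ x ∈ A ∧ A ⊆ O ∧
      (g x ≠ x → ∀ y ∈ A, g y ∉ A) := by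
    intro g
    by_cases hg : g x = x
    · exact ⟨interior O, isOpen_interior, mem_interior_iff_mem_nhds.2 hO, interior_subset,
        fun h => absurd hg h⟩
    · obtain ⟨W, W', hW, hW', hxW, hxW', hd⟩ := t2_separation (Ne.symm hg)
      refine ⟨interior O ∩ (W ∩ g ⁻¹' W'), isOpen_interior.inter (hW.inter
        (hW'.preimage g.continuous)), ⟨mem_interior_iff_mem_nhds.2 hO, hxW, hxW'⟩,
        inter_subset_left.trans interior_subset, fun _ y hy hgy => ?_⟩
      exact disjoint_left.1 hd hgy.2.1 hy.2.2
  choose A hAo hxA hAO hA using h1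
  have hNo : IsOpen (⋂ g : C.G, A g) := isOpen_iInter_of_finite fun g => hAo g
  set N := ⋂ g : C.G, A g with hN
  have hxN : x ∈ N := mem_iInter.2 fun g => hxA g
  have hNo' : IsOpen (⋂ g : C.G, {y | g.1 x = x → g.1 y ∈ N}) := by
    refine isOpen_iInter_of_finite fun g => ?_
    by_cases hg : g.1 x = x
    · simp only [hg, forall_const]
      exact hNo.preimage g.1.continuous
    · simp [hg]
  -- The intersection of the preimages of `N` under the stabilizer of `x`: it is stable under the
  -- stabilizer, and so is its component containing `x`.
  set N' := ⋂ g : C.G, {y | g.1 x = x → g.1 y ∈ N} with hN'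
  have hxN' : x ∈ N' := mem_iInter.2 fun g hg => by rw [hg]; exact hxN
  have hN'N : N' ⊆ N := fun y hy => mem_iInter.1 hy 1 rfl
  have hst : ∀ g ∈ C.G, g x = x → ∀ y ∈ N', g y ∈ N' := by
    intro g hg hgx y hy
    refine mem_iInter.2 fun k hk => ?_
    have h1 := mem_iInter.1 hy (k * (⟨g, hg⟩ : C.G))
    exact h1 ((congrArg k.1 hgx).trans hk)
  have hsub := connectedComponentIn_subset N' x
  refine ⟨⟨connectedComponentIn N' x, hNo'.connectedComponentIn⟩, mem_connectedComponentIn hxN',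
    fun y hy => hAO _ (mem_iInter.1 (hN'N (hsub hy)) 1),
    isConnected_connectedComponentIn_iff.2 hxN', ?_⟩
  rintro g hg ⟨y, hy, hgy⟩ z hz
  have hgx : g x = x := by
    by_contra h
    exact hA g h y (mem_iInter.1 (hN'N (hsub hy)) ⟨g, hg⟩)
      (mem_iInter.1 (hN'N (hsub hgy)) ⟨g, hg⟩)
  refine (isPreconnected_connectedComponentIn.image g g.continuous.continuousOn
    ).subset_connectedComponentIn (x := x) ⟨x, mem_connectedComponentIn hxN', hgx⟩ ?_
    (mem_image_of_mem g hz)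
  rintro _ ⟨w, hw, rfl⟩
  exact hst g hg hgx w (hsub hw)

/-- The restriction of an orbifold chart to an open connected subset which every element of `G`
either preserves or moves off itself. -/
noncomputable def OrbifoldChart.restrict (C : OrbifoldChart n Q) (S : TopologicalSpace.Opens C.carrier)
    (hS : IsConnected (S : Set C.carrier))
    (hG : ∀ g ∈ C.G, (∃ y ∈ S, g y ∈ S) → ∀ y ∈ S, g y ∈ S) : OrbifoldChart n Q :=
  haveI : ConnectedSpace S := isConnected_iff_connectedSpace.1 hS
  { carrier := S
    G :=
      { carrier := {k | ∃ g ∈ C.G, ∀ y : S, (k y : C.carrier) = g y}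
        one_mem' := ⟨1, C.G.one_mem, fun _ => rfl⟩
        mul_mem' := by
          rintro k l ⟨g, hg, hk⟩ ⟨h, hh, hl⟩
          exact ⟨g * h, C.G.mul_mem hg hh, fun y => (hk (l y)).trans (congrArg g (hl y))⟩
        inv_mem' := by
          rintro k ⟨g, hg, hk⟩
          refine ⟨g⁻¹, C.G.inv_mem hg, fun y => ?_⟩
          have h1 : (y : C.carrier) = g (k.symm y : S) := by
            rw [← hk, Homeomorph.apply_symm_apply]
          change ((k.symm y : S) : C.carrier) = g.symm y
          rw [h1, Homeomorph.symm_apply_apply] }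
    finite_G := by
      have := C.finite_G
      have hc : ∀ k : {k : S ≃ₜ S | ∃ g ∈ C.G, ∀ y : S, (k y : C.carrier) = g y},
          ∃ g : C.G, ∀ y : S, (k.1 y : C.carrier) = g.1 y := by
        rintro ⟨k, g, hg, hk⟩
        exact ⟨⟨g, hg⟩, hk⟩
      choose φ hφ using hc
      refine Finite.of_injective φ fun k l hkl => ?_
      -- An element of the restricted group is determined by any extension to the whole chart.
      ext y
      rw [hφ, hφ, hkl]
    smooth_G := by
      rintro k ⟨g, hg, hk⟩
      rw [← ContMDiff.subtypeVal_comp_iff]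
      have : (Subtype.val : S → C.carrier) ∘ k = g ∘ Subtype.val := funext hk
      rw [this]
      exact (C.smooth_G g hg).comp contMDiff_subtype_val
    proj := fun y => C.proj y
    isOpen_range := (C.isOpenMap_proj.comp S.2.isOpenMap_subtype_val).isOpen_range
    proj_eq_iff := by
      intro x y
      rw [C.proj_eq_iff]
      constructor
      · rintro ⟨g, hg, hxy⟩
        -- Both `g` and its inverse send a point of `S` into `S`, so both preserve `S`, and `g`
        -- restricts to a homeomorphism of `S`.
        have h1 := hG g hg ⟨x, x.2, by rw [hxy]; exact y.2⟩
        have h2 := hG g⁻¹ (C.G.inv_mem hg) ⟨y, y.2, by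
          rw [← hxy]; exact (g.symm_apply_apply x).symm ▸ x.2⟩
        refine ⟨⟨⟨fun z => ⟨g z, h1 z z.2⟩, fun z => ⟨g.symm z, h2 z z.2⟩,
          fun z => Subtype.ext (g.symm_apply_apply _), fun z => Subtype.ext (g.apply_symm_apply _)⟩,
          ?_, ?_⟩, ⟨g, hg, fun _ => rfl⟩, Subtype.ext hxy⟩
        · exact (g.continuous.comp continuous_subtype_val).subtype_mk _
        · exact (g.symm.continuous.comp continuous_subtype_val).subtype_mk _
      · rintro ⟨k, ⟨g, hg, hk⟩, rfl⟩
        exact ⟨g, hg, (hk x).symm⟩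
    isQuotientMap := by
      have hc : Continuous C.proj := continuous_subtype_val.comp C.isQuotientMap.continuous
      refine IsOpenMap.isQuotientMap ?_ ((hc.comp continuous_subtype_val).subtype_mk _)
        rangeFactorization_surjective
      intro O hO
      have h1 := C.isOpenMap_proj _ (S.2.isOpenMap_subtype_val _ hO)
      convert! h1.preimage continuous_subtype_val
      ext ⟨q, hq⟩
      simp only [mem_image, mem_preimage, exists_exists_and_eq_and, Subtype.ext_iff,
        rangeFactorization_coe]
      rfl }

theorem OrbifoldChart.isEmbedding_restrict (C : OrbifoldChart n Q)
    (S : TopologicalSpace.Opens C.carrier) (hS : IsConnected (S : Set C.carrier))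
    (hG : ∀ g ∈ C.G, (∃ y ∈ S, g y ∈ S) → ∀ y ∈ S, g y ∈ S) :
    (C.restrict S hS hG).IsEmbedding C (Subtype.val : S → C.carrier) :=
  ⟨S.2.isOpenEmbedding_subtypeVal, fun x => locDiffAt_subtype_val S x, fun _ => rfl⟩

theorem OrbifoldChart.IsEmbedding.related {C D : OrbifoldChart n Q} {e : C.carrier → D.carrier}
    (h : C.IsEmbedding D e) (x : C.carrier) : C.Related D x (e x) :=
  ⟨e, h.2.1 x, rfl, Eventually.of_forall h.2.2⟩

theorem OrbifoldChart.IsEmbedding.mem {U : OrbifoldStructure n Q} {C D : OrbifoldChart n Q}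
    {e : C.carrier → D.carrier} (h : C.IsEmbedding D e) (hD : D ∈ U.charts) : C ∈ U.charts :=
  U.mem_of_related fun x => ⟨D, hD, _, h.related x⟩

theorem OrbifoldChart.IsEmbedding.comp {C D E : OrbifoldChart n Q} {e' : D.carrier → E.carrier}
    {e : C.carrier → D.carrier} (h' : D.IsEmbedding E e') (h : C.IsEmbedding D e) :
    C.IsEmbedding E (e' ∘ e) :=
  ⟨h'.1.comp h.1, fun x => LocDiffAt.comp (h'.2.1 _) (h.2.1 x),
    fun x => (h'.2.2 _).trans (h.2.2 x)⟩

/-- A germ of a transition between two charts of the structure is realized by embeddings of an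
arbitrarily small chart of the structure. -/
theorem OrbifoldStructure.exists_isEmbedding (U : OrbifoldStructure n Q) {C D : OrbifoldChart n Q}
    (hC : C ∈ U.charts) {x : C.carrier} {k : C.carrier → D.carrier} (hk : LocDiffAt n k x)
    (hp : ∀ᶠ z in 𝓝 x, D.proj (k z) = C.proj z) {O : Set C.carrier} (hO : O ∈ 𝓝 x) :
    ∃ E ∈ U.charts, ∃ e : E.carrier → C.carrier, E.IsEmbedding C e ∧ E.IsEmbedding D (k ∘ e) ∧
      x ∈ range e ∧ range e ⊆ O := by
  obtain ⟨h, h1, h2, hx, hs, he⟩ := hk.exists_openPartialHomeomorph (inter_mem hp hO)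
  obtain ⟨S, hxS, hSh, hS, hG⟩ := C.exists_stable_nhd x (h.open_source.mem_nhds hx)
  have hemb := C.isEmbedding_restrict S hS hG
  have hl : ∀ y : S, LocDiffAt n (k ∘ (Subtype.val : S → C.carrier)) y := fun y =>
    LocDiffAt.comp ((locDiffAt_of_contMDiffOn h1 h2 (hSh y.2)).congr
      (eventually_of_mem (h.open_source.mem_nhds (hSh y.2)) fun z hz => (he hz).symm))
      (locDiffAt_subtype_val S y)
  refine ⟨C.restrict S hS hG, hemb.mem hC, Subtype.val, hemb, ⟨?_, hl, fun y => ?_⟩, ⟨⟨x, hxS⟩, rfl⟩,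
    ?_⟩
  -- Injectivity is inherited from the partial homeomorphism `h`, openness from the local
  -- diffeomorphism property.
  · refine .of_continuous_injective_isOpenMap
      (continuous_iff_continuousAt.2 fun y => (hl y).continuousAt) (fun y z hyz => ?_)
      (isOpenMap_of_locDiffAt hl)
    refine Subtype.ext (h.injOn (hSh y.2) (hSh z.2) ?_)
    rw [← he (hSh y.2), ← he (hSh z.2)]
    exact hyz
  · exact (hs (hSh y.2)).1
  · rintro _ ⟨y, rfl⟩
    exact (hs (hSh y.2)).2

end Small

/-! ### The pseudogroup of an atlas and embeddings of charts -/

section Psi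

variable {n : ℕ} {Q : Type u} [TopologicalSpace Q] {V : OrbifoldAtlas n Q}

/-- Two embeddings of a chart of the structure into charts of the atlas define an element of
`Ψ(V)`. -/
theorem OrbifoldAtlas.exists_isChartEmbedding {E : OrbifoldChart n Q}
    (hE : E ∈ V.structureCharts) {C D : V.charts} {e : E.carrier → C.1.carrier}
    {e' : E.carrier → D.1.carrier} (he : E.IsEmbedding C.1 e) (he' : E.IsEmbedding D.1 e') :
    ∃ b, V.IsChartEmbedding b ∧ b.source = range (fun x => (⟨C, e x⟩ : V.Total)) ∧
      ∀ x, b ⟨C, e x⟩ = ⟨D, e' x⟩ := by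
  have hj : IsOpenEmbedding fun x => (⟨C, e x⟩ : V.Total) := (isOpenEmbedding_mk V C).comp he.1
  have hj' : IsOpenEmbedding fun x => (⟨D, e' x⟩ : V.Total) := (isOpenEmbedding_mk V D).comp he'.1
  have hl : ∀ x, LocDiffAt n (fun x => (⟨C, e x⟩ : V.Total)) x := fun x =>
    LocDiffAt.comp (locDiffAt_mk V C _) (he.2.1 x)
  have hl' : ∀ x, LocDiffAt n (fun x => (⟨D, e' x⟩ : V.Total)) x := fun x =>
    LocDiffAt.comp (locDiffAt_mk V D _) (he'.2.1 x)
  -- Back along the first embedding, then out along the second.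
  let b := (hj.toOpenPartialHomeomorph _).symm.trans (hj'.toOpenPartialHomeomorph _)
  have hb : ∀ x, b ⟨C, e x⟩ = ⟨D, e' x⟩ := fun x =>
    congrArg (fun x => (⟨D, e' x⟩ : V.Total)) (hj.toOpenPartialHomeomorph_left_inv _)
  have hs : b.source = range (fun x => (⟨C, e x⟩ : V.Total)) := by
    simp [b]
  have hPsi : b ∈ V.Psi := by
    refine ⟨isTransition_iff_locDiffAt.2 fun p hp => ?_, fun p hp => ?_⟩
    · rw [hs] at hp
      obtain ⟨x, rfl⟩ := hp
      refine LocDiffAt.of_comp_right (f := fun x => (⟨C, e x⟩ : V.Total)) (hl x) ((hl' x).congr (Eventually.of_forall fun y => ?_))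
      exact (hb y).symm
    · rw [hs] at hp
      obtain ⟨x, rfl⟩ := hp
      simp only [hb]
      exact (he'.2.2 x).trans (he.2.2 x).symm
  exact ⟨b, ⟨hPsi, E, hE, C, D, e, e', he, he', hs, hb⟩, hs, hb⟩

theorem OrbifoldAtlas.IsChartEmbedding.isChangeOfCharts
    {f : OpenPartialHomeomorph V.Total V.Total} (hf : V.IsChartEmbedding f) :
    V.IsChangeOfCharts f := by
  obtain ⟨hf, E, -, C, D, e, e', -, -, hs, h⟩ := hf
  refine ⟨hf, C, D, ?_, fun p hp => ?_⟩
  · rw [hs]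
    rintro _ ⟨x, rfl⟩
    exact ⟨e x, rfl⟩
  · have h1 := f.map_target hp
    rw [hs] at h1
    obtain ⟨x, hx⟩ := h1
    refine ⟨e' x, ?_⟩
    exact (h x).symm.trans ((congrArg f hx).trans (f.right_inv hp))

/-- Elements of `Ψ(V)` are related germs of charts. -/
theorem OrbifoldAtlas.exists_locDiffAt_of_mem_Psi {f : OpenPartialHomeomorph V.Total V.Total}
    (hf : f ∈ V.Psi) {C D : V.charts} {x : C.1.carrier} {y : D.1.carrier}
    (hx : (⟨C, x⟩ : V.Total) ∈ f.source) (hy : f ⟨C, x⟩ = ⟨D, y⟩) :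
    ∃ k : C.1.carrier → D.1.carrier, LocDiffAt n k x ∧
      (∀ᶠ z in 𝓝 x, D.1.proj (k z) = C.1.proj z) ∧
      ∀ᶠ z in 𝓝 x, (⟨C, z⟩ : V.Total) ∈ f.source ∧ f ⟨C, z⟩ = ⟨D, k z⟩ := by
  have hC := locDiffAt_mk V C x
  have hfC : LocDiffAt n (fun z => f ⟨C, z⟩) x :=
    LocDiffAt.comp (isTransition_iff_locDiffAt.1 hf.1 _ hx) hC
  -- Near `x` the values of `f` stay in the summand `D`, so a local inverse of its inclusion turns
  -- `f` into a map between the two charts.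
  obtain ⟨g, hg, hgy, -, hDg⟩ := (locDiffAt_mk V D y).exists_inverse
  rw [← hy] at hg hDg
  have h1 : ∀ᶠ z in 𝓝 x, (⟨C, z⟩ : V.Total) ∈ f.source ∧ f ⟨C, z⟩ = ⟨D, g (f ⟨C, z⟩)⟩ := by
    filter_upwards [hC.continuousAt.eventually (f.open_source.mem_nhds hx),
      hfC.continuousAt.eventually hDg] with z h1 h2
    exact ⟨h1, h2.symm⟩
  refine ⟨fun z => g (f ⟨C, z⟩), LocDiffAt.comp hg hfC, ?_, h1⟩
  filter_upwards [h1] with z hz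
  have h2 := hf.2 _ hz.1
  rw [hz.2] at h2
  exact h2

/-- Related points of two charts of an atlas are related by an element of `Ψ(V)`. -/
theorem OrbifoldAtlas.exists_mem_Psi {U : OrbifoldStructure n Q} (hV : V.IsRepresentative U)
    {p q : V.Total} (h : V.proj p = V.proj q) : ∃ f ∈ V.Psi, p ∈ f.source ∧ f p = q := by
  obtain ⟨C, x⟩ := p
  obtain ⟨D, y⟩ := q
  obtain ⟨k, hk, rfl, hp⟩ := U.related (hV C.2) (hV D.2) h
  obtain ⟨E, hE, e, he, he', ⟨z, rfl⟩, -⟩ := U.exists_isEmbedding (hV C.2) hk hp univ_mem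
  obtain ⟨b, hb, hs, hbe⟩ := exists_isChartEmbedding (hV.subset_structureCharts hE) he he'
  exact ⟨b, hb.1, by rw [hs]; exact ⟨z, rfl⟩, hbe z⟩

/-- Each germ of Ψ is realized on a small chart of the structure. This supplies a canonical choice
of `P` whose elements are themselves of the kind required of the values of `ν`. -/
theorem OrbifoldAtlas.isGeneratedBy_isChartEmbedding {U : OrbifoldStructure n Q}
    (hV : V.IsRepresentative U) : IsGeneratedBy V.Psi {b | V.IsChartEmbedding b} := by
  refine ⟨fun b hb => hb.1, ?_⟩
  rintro f hf ⟨C, x⟩ hx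
  obtain ⟨k, hk, hp, hfk⟩ := exists_locDiffAt_of_mem_Psi hf (D := (f ⟨C, x⟩).1)
    (y := (f ⟨C, x⟩).2) hx rfl
  obtain ⟨E, hE, e, he, he', ⟨z, rfl⟩, hO⟩ := U.exists_isEmbedding (hV C.2) hk hp hfk
  obtain ⟨b, hb, hs, hbe⟩ := exists_isChartEmbedding (hV.subset_structureCharts hE) he he'
  have hz : (⟨C, e z⟩ : V.Total) ∈ b.source := by rw [hs]; exact ⟨z, rfl⟩
  refine ⟨b, hb, hz, b.source, b.open_source, hz, fun p hp => ⟨?_, hp⟩, fun p hp => ?_⟩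
  · rw [hs] at hp
    obtain ⟨w, rfl⟩ := hp
    exact (hO ⟨w, rfl⟩).1
  · rw [hs] at hp
    obtain ⟨w, rfl⟩ := hp
    exact (hO ⟨w, rfl⟩).2.trans (hbe w).symm

end Psi

/-! ### Charted orbifold maps whose local lifts are open -/

section Maps

variable {n n' : ℕ} {Q Q' : Type u} [TopologicalSpace Q] [TopologicalSpace Q']
  {V : OrbifoldAtlas n Q} {V' : OrbifoldAtlas n' Q'}

/-- If the local lifts are open maps, then the germs `ν(a)` are determined by equivariance. -/
theorem LiftFamily.eventuallyEq_of_comp_total {L : LiftFamily V V'} (hL : IsOpenMap L.total)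
    {x : V.Total} {α : Type*} {g h : V'.Total → α}
    (hgh : ∀ᶠ y in 𝓝 x, g (L.total y) = h (L.total y)) : g =ᶠ[𝓝 (L.total x)] h :=
  -- An open map sends neighbourhoods of `x` to neighbourhoods of its image, so agreement after
  -- composition with ψ is agreement of germs.
  hL.nhds_le x hgh

theorem OrbMapRep.equivalent_of_isOpenMap {r s : OrbMapRep V V'}
    (h : r.toLiftFamily = s.toLiftFamily) (hr : IsOpenMap r.total) : r.Equivalent s := by
  refine ⟨h, fun a b x hxa hxb hab => LiftFamily.eventuallyEq_of_comp_total hr ?_⟩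
  filter_upwards [hab, a.1.open_source.mem_nhds hxa, b.1.open_source.mem_nhds hxb] with y h1 h2 h3
  rw [← r.equivariant a y h2, h1, h, s.equivariant b y h3]

/-- A charted orbifold map with open local lifts is determined by its local lifts. -/
theorem OrbMap.ext_of_isOpenMap {φ χ : OrbMap V V'} (h : φ.liftFamily = χ.liftFamily)
    (hφ : IsOpenMap φ.liftFamily.total) : φ = χ := by
  induction φ using Quotient.inductionOn with | _ r
  induction χ using Quotient.inductionOn with | _ s
  exact Quotient.sound (OrbMapRep.equivalent_of_isOpenMap h hφ)

theorem OrbMap.liftFamily_comp {n'' : ℕ} {Q'' : Type u} [TopologicalSpace Q'']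
    {V'' : OrbifoldAtlas n'' Q''} (χ : OrbMap V' V'') (φ : OrbMap V V') :
    (χ.comp φ).liftFamily = χ.liftFamily.comp φ.liftFamily := by
  induction φ using Quotient.inductionOn with | _ r
  induction χ using Quotient.inductionOn with | _ s
  rfl

end Maps

/-! ### Local lifts that are local diffeomorphisms -/

section LocalDiffeomorphicLifts

variable {n : ℕ} {Q Q' : Type u} [TopologicalSpace Q] [TopologicalSpace Q']
  {V : OrbifoldAtlas n Q} {V' : OrbifoldAtlas n Q'}

/-- The inclusions of the summands are local diffeomorphisms and can be cancelled on either side. -/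
theorem LiftFamily.locDiffAt_total_iff (L : LiftFamily V V') (C : V.charts) (x : C.1.carrier) :
    LocDiffAt n L.total ⟨C, x⟩ ↔ LocDiffAt n (L.lift C) x := by
  have hC := locDiffAt_mk V C x
  have hD := locDiffAt_mk V' (L.idx C) (L.lift C x)
  exact ⟨fun h => hD.of_comp_left (L.isLocalLift C).1.continuous.continuousAt
      (LocDiffAt.comp (g := L.total) h hC),
    fun h => LocDiffAt.of_comp_right (g := L.total) hC
      (LocDiffAt.comp (f := L.lift C) hD h)⟩

theorem OrbMap.isLiftOfId_iff {W W' : OrbifoldAtlas n Q} {φ : OrbMap W W'} :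
    φ.IsLiftOfId ↔ φ.liftFamily.f = id ∧ ∀ p, LocDiffAt n φ.liftFamily.total p :=
  and_congr_right fun _ =>
    ⟨fun h p => (φ.liftFamily.locDiffAt_total_iff p.1 p.2).2 (h p.1 p.2),
      fun h C x => (φ.liftFamily.locDiffAt_total_iff C x).1 (h ⟨C, x⟩)⟩

/-- A family of local lifts which are open embeddings of charts underlies a charted orbifold
map. -/
theorem exists_orbMap_of_isEmbedding {U : OrbifoldStructure n Q} {W V : OrbifoldAtlas n Q}
    (hW : W.IsRepresentative U) (hV : V.IsRepresentative U) (L : LiftFamily W V)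
    (hL : ∀ C : W.charts, C.1.IsEmbedding (L.idx C).1 (L.lift C)) : ∃ φ : OrbMap W V, φ.liftFamily = L := by
  have hopen : IsOpenMap L.total := isOpenMap_of_locDiffAt (n := n) fun p =>
    (L.locDiffAt_total_iff p.1 p.2).2 ((hL p.1).2.1 p.2)
  have hν : ∀ a : {a | W.IsChartEmbedding a}, ∃ b, V.IsChartEmbedding b ∧
      ∀ x ∈ a.1.source, L.total x ∈ b.source ∧ L.total (a.1 x) = b (L.total x) := by
    rintro ⟨a, -, E, hE, C, D, e, e', he, he', hs, ha⟩
    have hEU : E ∈ U.charts := he.mem (hW C.2)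
    -- If `a` is given by embeddings `e`, `e'` of `E`, then `ν a` is given by their composites with
    -- the lifts, which embed the same chart `E` into charts of `V`.
    obtain ⟨b, hb, hbs, hbe⟩ := OrbifoldAtlas.exists_isChartEmbedding
      (hV.subset_structureCharts hEU) ((hL C).comp he) ((hL D).comp he')
    refine ⟨b, hb, fun x hx => ?_⟩
    rw [hs] at hx
    obtain ⟨z, rfl⟩ := hx
    have hz : L.total ⟨C, e z⟩ ∈ b.source := by rw [hbs]; exact mem_range_self z
    exact ⟨hz, (congrArg L.total (ha z)).trans (hbe z).symm⟩
  choose ν hνE hν using hν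
  have hgen := OrbifoldAtlas.isGeneratedBy_isChartEmbedding hW
  refine ⟨Quotient.mk _
    { toLiftFamily := L
      P := {a | W.IsChartEmbedding a}
      isChangeOfCharts := fun a ha => ha.isChangeOfCharts
      isQuasiPseudogroup := hgen.isQuasiPseudogroup
      isGeneratedBy := hgen
      ν := ν
      isChartEmbedding := hνE
      mem_source := fun a x hx => (hν a x hx).1
      equivariant := fun a x hx => (hν a x hx).2
      germ_congr := ?_
      germ_mul := ?_
      germ_one := ?_ }, rfl⟩
  -- In all three germ conditions equivariance moves the claim to the given relation in `P`;
  -- openness of ψ then cancels ψ.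
  · intro a b x hxa hxb hab
    refine LiftFamily.eventuallyEq_of_comp_total hopen ?_
    filter_upwards [hab, a.1.open_source.mem_nhds hxa, b.1.open_source.mem_nhds hxb] with y h1 h2 h3
    rw [← (hν a y h2).2, h1, (hν b y h3).2]
  · intro a b c x hxa hxb hxc habc
    refine LiftFamily.eventuallyEq_of_comp_total hopen ?_
    filter_upwards [habc, a.1.open_source.mem_nhds hxa, c.1.open_source.mem_nhds hxc,
      (a.1.continuousAt hxa).eventually (b.1.open_source.mem_nhds hxb)] with y h1 h2 h3 h4
    rw [← (hν a y h2).2, ← (hν b _ h4).2, h1, (hν c y h3).2]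
  · intro a x hxa ha
    refine LiftFamily.eventuallyEq_of_comp_total hopen ?_
    filter_upwards [ha, a.1.open_source.mem_nhds hxa] with y h1 h2
    rw [← (hν a y h2).2, h1]
    rfl

end LocalDiffeomorphicLifts

/-! ### Lifts of the identity -/

section LiftsOfId

variable {n : ℕ} {Q : Type u} [TopologicalSpace Q] {U : OrbifoldStructure n Q}

theorem LiftFamily.proj_total {n' : ℕ} {Q' : Type u} [TopologicalSpace Q'] {V : OrbifoldAtlas n Q}
    {V' : OrbifoldAtlas n' Q'} (L : LiftFamily V V') (p : V.Total) :
    V'.proj (L.total p) = L.f (V.proj p) :=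
  (L.isLocalLift p.1).2 p.2

theorem OrbifoldAtlas.exists_proj_eq (V : OrbifoldAtlas n Q) (q : Q) :
    ∃ p : V.Total, V.proj p = q := by
  obtain ⟨C, hC, x, hx⟩ := V.covers q
  exact ⟨⟨⟨C, hC⟩, x⟩, hx⟩

theorem OrbMap.IsLiftOfId.comp {V V' V'' : OrbifoldAtlas n Q} {χ : OrbMap V' V''}
    {φ : OrbMap V V'} (hχ : χ.IsLiftOfId) (hφ : φ.IsLiftOfId) : (χ.comp φ).IsLiftOfId := by
  rw [OrbMap.isLiftOfId_iff] at hχ hφ ⊢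
  rw [OrbMap.liftFamily_comp]
  refine ⟨?_, fun p => ?_⟩
  · change χ.liftFamily.f ∘ φ.liftFamily.f = id
    rw [hχ.1, hφ.1]
    rfl
  · exact LocDiffAt.comp (hχ.2 _) (hφ.2 p)

/-- The range atlas of a lift of the identity represents the same structure as its domain
atlas. -/
theorem OrbMap.IsLiftOfId.isRepresentative {V V' : OrbifoldAtlas n Q} {φ : OrbMap V V'}
    (hφ : φ.IsLiftOfId) (hV : V.IsRepresentative U) : V'.IsRepresentative U := by
  intro D hD
  refine U.mem_of_related fun y => ?_
  obtain ⟨⟨C, x⟩, hp⟩ := V.exists_proj_eq (D.proj y)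
  refine ⟨C.1, hV C.2, x, ?_⟩
  have h1 : ∀ x, (φ.liftFamily.idx C).1.proj (φ.liftFamily.lift C x) = C.1.proj x := fun x => by
    rw [(φ.liftFamily.isLocalLift C).2, hφ.1]
    rfl
  have h2 : C.1.Related (φ.liftFamily.idx C).1 x (φ.liftFamily.lift C x) :=
    ⟨_, hφ.2 C x, rfl, Eventually.of_forall h1⟩
  -- The lift of `x` and `y` lie over the same point because the underlying map is the identity, and
  -- both belong to charts of the atlas `V'`.
  have h3 : (φ.liftFamily.idx C).1.Related D (φ.liftFamily.lift C x) y :=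
    OrbifoldChart.compatible_iff.1 (V'.compatible _ (φ.liftFamily.idx C).2 D hD) _ _
      ((h1 x).trans hp)
  exact (h2.trans h3).symm

/-- Whether the local lifts are local diffeomorphisms can be tested at one point of each fibre. -/
theorem OrbMap.locDiffAt_total_of_proj_eq {Q' : Type u} [TopologicalSpace Q']
    {V : OrbifoldAtlas n Q} {V' : OrbifoldAtlas n Q'} (φ : OrbMap V V')
    (hV : V.IsRepresentative U) {p q : V.Total} (h : V.proj p = V.proj q)
    (hq : LocDiffAt n φ.liftFamily.total q) : LocDiffAt n φ.liftFamily.total p := by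
  induction φ using Quotient.inductionOn with | _ r
  change LocDiffAt n r.total q at hq
  change LocDiffAt n r.total p
  obtain ⟨f, hf, hpf, rfl⟩ := OrbifoldAtlas.exists_mem_Psi hV h
  obtain ⟨a, hpa, hfa⟩ := r.exists_germ hf hpf
  rw [hfa.eq_of_nhds] at hq
  -- Near `p`, `ν a ∘ ψ = ψ ∘ a`. The right side is a local diffeomorphism at `p` by the assumption
  -- at `a p`, and `ν a` cancels on the left.
  refine LocDiffAt.of_comp_left (g := r.ν a) (isTransition_iff_locDiffAt.1
    (r.isChartEmbedding a).1.1 _ (r.mem_source a p hpa)) r.continuous_total.continuousAt ?_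
  refine (LocDiffAt.comp hq
    (isTransition_iff_locDiffAt.1 (r.isChangeOfCharts _ a.2).1.1 p hpa)).congr ?_
  filter_upwards [a.1.open_source.mem_nhds hpa] with y hy
  exact r.equivariant a y hy

/-- Any two atlases of the same structure have a common refinement by small charts. -/
theorem OrbifoldStructure.exists_common_refinement (U : OrbifoldStructure n Q)
    {V₁ V₂ : OrbifoldAtlas n Q} (h₁ : V₁.IsRepresentative U) (h₂ : V₂.IsRepresentative U) :
    ∃ W : OrbifoldAtlas n Q, W.IsRepresentative U ∧
      (∃ ε : OrbMap W V₁, ε.IsLiftOfId) ∧ ∃ ε : OrbMap W V₂, ε.IsLiftOfId := by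
  let charts : Set (OrbifoldChart n Q) := {E | E ∈ U.charts ∧
    (∃ C : V₁.charts, ∃ e, E.IsEmbedding C.1 e) ∧ ∃ C : V₂.charts, ∃ e, E.IsEmbedding C.1 e}
  have hcov : ∀ q, ∃ E ∈ charts, q ∈ range E.proj := by
    intro q
    obtain ⟨⟨C, x⟩, rfl⟩ := V₁.exists_proj_eq q
    obtain ⟨⟨D, y⟩, hy⟩ := V₂.exists_proj_eq (C.1.proj x)
    -- A small chart around `x` on which `k` is an embedding embeds into `C` by inclusion and into
    -- `D` through `k`.
    obtain ⟨k, hk, -, hp⟩ := U.related (h₁ C.2) (h₂ D.2) hy.symm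
    obtain ⟨E, hE, e, he, he', ⟨z, rfl⟩, -⟩ := U.exists_isEmbedding (h₁ C.2) hk hp univ_mem
    exact ⟨E, ⟨hE, ⟨C, e, he⟩, D, _, he'⟩, z, (he.2.2 z).symm⟩
  let W : OrbifoldAtlas n Q :=
    ⟨charts, fun C hC D hD => U.compatible C hC.1 D hD.1, hcov⟩
  have hW : W.IsRepresentative U := fun C hC => hC.1
  have key : ∀ V : OrbifoldAtlas n Q, V.IsRepresentative U →
      (∀ E : W.charts, ∃ C : V.charts, ∃ e, E.1.IsEmbedding C.1 e) →
      ∃ ε : OrbMap W V, ε.IsLiftOfId := by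
    intro V hV h
    choose i e he using h
    obtain ⟨ε, hε⟩ := exists_orbMap_of_isEmbedding hW hV
      ⟨id, continuous_id, i, e, fun C =>
        ⟨IsLocalDiffeomorph.contMDiff (he C).2.1, (he C).2.2⟩⟩ he
    refine ⟨ε, ?_, ?_⟩
    · rw [hε]
    · rw [hε]
      exact fun C => (he C).2.1
  exact ⟨W, hW, key V₁ h₁ fun E => E.2.2.1, key V₂ h₂ fun E => E.2.2.2⟩

/-- The charted orbifold map given by the identities of all charts. -/
theorem OrbifoldAtlas.exists_identity {W : OrbifoldAtlas n Q} (hW : W.IsRepresentative U) :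
    ∃ ι : OrbMap W W, ι.IsLiftOfId ∧
      ι.liftFamily = ⟨id, continuous_id, id, fun _ => id, fun _ => ⟨contMDiff_id, fun _ => rfl⟩⟩ := by
  have he : ∀ C : W.charts, C.1.IsEmbedding C.1 id := fun C =>
    ⟨.id, (Diffeomorph.refl (𝓡 n) C.1.carrier ∞).isLocalDiffeomorph, fun _ => rfl⟩
  obtain ⟨ι, hι⟩ := exists_orbMap_of_isEmbedding hW hW
    ⟨id, continuous_id, id, fun _ => id, fun _ => ⟨contMDiff_id, fun _ => rfl⟩⟩ he
  refine ⟨ι, ⟨?_, ?_⟩, hι⟩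
  · rw [hι]
  · rw [hι]
    exact fun C => (he C).2.1

/-- The middle map may be the identity of the common refinement, since a lift of the identity
precomposed with a lift of the identity is again one and can serve as `ε'`. -/
theorem ChartedOrbMap.equivalent_of_mem_liftsOfId {φ χ : ChartedOrbMap n Q n Q}
    (hφ : φ ∈ liftsOfId U) (hχ : χ ∈ liftsOfId U) : φ.Equivalent χ := by
  obtain ⟨W, hW, ⟨ε₁, h₁⟩, ε₂, h₂⟩ := U.exists_common_refinement hφ.1 hχ.1
  obtain ⟨ι, hι, hιL⟩ := OrbifoldAtlas.exists_identity hW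
  -- The two sides have the same lifts, and openness of these makes the classes `[P, ν]` agree.
  have key : ∀ {V : OrbifoldAtlas n Q} {ε : OrbMap W V}, ε.IsLiftOfId → ε = ε.comp ι := by
    intro V ε hε
    refine OrbMap.ext_of_isOpenMap ?_ (isOpenMap_of_locDiffAt (OrbMap.isLiftOfId_iff.1 hε).2)
    rw [OrbMap.liftFamily_comp, hιL]
    rfl
  exact ⟨U, U, hφ.1, hχ.1, hφ.2.isRepresentative hφ.1, hχ.2.isRepresentative hχ.1, W, W, hW, hW,
    ε₁, ε₂, φ.map.comp ε₁, χ.map.comp ε₂, ι, h₁, h₂, hφ.2.comp h₁, hχ.2.comp h₂,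
    key (hφ.2.comp h₁), key (hχ.2.comp h₂)⟩

/-- Being a local diffeomorphism over the identity passes from `φ` to `k` through the first square
and from `k` to `χ` through the second, by cancellation. -/
theorem ChartedOrbMap.Equivalent.mem_liftsOfId {φ χ : ChartedOrbMap n Q n Q}
    (h : φ.Equivalent χ) (hφ : φ ∈ liftsOfId U) : χ ∈ liftsOfId U := by
  obtain ⟨U₁, U', hφ₁, hχ₁, -, -, W, W', hW, -, ε₁, ε₂, ε₁', ε₂', k, h₁, h₂, h₁', h₂', e₁, e₂⟩ := h
  have hφ₂ := hφ.2
  rw [OrbMap.isLiftOfId_iff] at h₁ h₂ h₁' h₂' hφ₂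
  replace e₁ := congrArg OrbMap.liftFamily e₁
  replace e₂ := congrArg OrbMap.liftFamily e₂
  simp only [OrbMap.liftFamily_comp] at e₁ e₂
  have f₁ : φ.map.liftFamily.f ∘ ε₁.liftFamily.f = ε₁'.liftFamily.f ∘ k.liftFamily.f :=
    congrArg LiftFamily.f e₁
  have f₂ : χ.map.liftFamily.f ∘ ε₂.liftFamily.f = ε₂'.liftFamily.f ∘ k.liftFamily.f :=
    congrArg LiftFamily.f e₂
  have t₁ : φ.map.liftFamily.total ∘ ε₁.liftFamily.total =
      ε₁'.liftFamily.total ∘ k.liftFamily.total := congrArg LiftFamily.total e₁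
  have t₂ : χ.map.liftFamily.total ∘ ε₂.liftFamily.total =
      ε₂'.liftFamily.total ∘ k.liftFamily.total := congrArg LiftFamily.total e₂
  rw [hφ₂.1, h₁.1, h₁'.1] at f₁
  rw [h₂.1, h₂'.1] at f₂
  have hk : ∀ w, LocDiffAt n k.liftFamily.total w := fun w =>
    LocDiffAt.of_comp_left (h₁'.2 _) k.liftFamily.continuous_total.continuousAt
      (by rw [← t₁]; exact LocDiffAt.comp (hφ₂.2 _) (h₁.2 w))
  -- The structure `U₁` in the equivalence is not given as `U`, but the domain atlas of `φ`
  -- represents both.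
  refine ⟨hχ₁.trans (OrbifoldAtlas.IsRepresentative.subset hφ.1 hφ₁),
    OrbMap.isLiftOfId_iff.2 ⟨f₂.trans f₁.symm, fun p => ?_⟩⟩
  -- The point `p` may lie outside the image of `ε₂`; the image of `w` is another point of its
  -- fibre, where `ε₂` can be cancelled.
  obtain ⟨w, hw⟩ := W.exists_proj_eq (χ.dom.proj p)
  refine χ.map.locDiffAt_total_of_proj_eq hχ₁ (q := ε₂.liftFamily.total w) ?_ ?_
  · rw [LiftFamily.proj_total, h₂.1, hw]
    rfl
  · refine LocDiffAt.of_comp_right (h₂.2 w) ?_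
    rw [t₂]
    exact LocDiffAt.comp (h₂'.2 _) (hk w)

end LiftsOfId

end ReducedOrbifold

theorem mainTheorem6 (n : ℕ) (Q : Type u) [TopologicalSpace Q] [T2Space Q]
    [SecondCountableTopology Q] (U : ReducedOrbifold.OrbifoldStructure n Q)
    (ε : ReducedOrbifold.ChartedOrbMap n Q n Q) (hε : ε ∈ ReducedOrbifold.liftsOfId U) :
    ε.equivClass = ReducedOrbifold.liftsOfId U :=
  Subset.antisymm (fun _ h => h.mem_liftsOfId hε) fun _ h =>
    ReducedOrbifold.ChartedOrbMap.equivalent_of_mem_liftsOfId hε h
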